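/- Let $\mathcal P=\{1,\dots,N\}$ carry a partial order $\preceq$ such that $i\preceq j$ implies $i\le j$, and let $\mathbf m=(m_i)_{i=1}^N$, $\mathbf n=(n_i)_{i=1}^N$ be multiindices of nonnegative integers. Let $\mathfrak M_{\mathcal P}(\mathbf m\times\mathbf n,\mathbb Z)$ be the set of integer block matrices $B=(B\{i,j\})_{i,j=1}^N$ with $B\{i,j\}$ of size $m_i\times n_j$ (the empty matrix if $m_i=0$ or $n_j=0$) such that $B\{i,j\}\neq 0$ implies $i\preceq j$; write $B\{i\}=B\{i,i\}$. Let $\mathrm{SL}_{\mathcal P}(\mathbf n,\mathbb Z)$ be the set of those $U\in\mathfrak M_{\mathcal P}(\mathbf n\times\mathbf n,\mathbb Z)$ that have an inverse in $\mathfrak M_{\mathcal P}(\mathbf n\times\mathbf n,\mathbb Z)$ and satisfy $\det U\{i\}=1$ whenever $n_i\neq 0$. Let $\mathfrak M^+_{\mathcal P}(\mathbf m\times\mathbf n,\mathbb Z)$ be the set of all $B\in\mathfrak M_{\mathcal P}(\mathbf m\times\mathbf n,\mathbb Z)$ such that (i) if $i\preceq j$ and $B\{i,j\}$ is not the empty matrix,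 then all entries of $B\{i,j\}$ are positive; (ii) if $B\{i\}$ is not the empty matrix, then all entries of $B\{i\}$ are positive, the Smith normal form of $B\{i\}$ over $\mathbb Z$ has at least two $1$'s, and $m_i,n_i\ge 3$. A basic elementary matrix is a square matrix that equals the identity matrix except for one offdiagonal entry, which is $1$ or $-1$. **Theorem.** Let $B,B'\in\mathfrak M^+_{\mathcal P}(\mathbf m\times\mathbf n,\mathbb Z)$ with $n_i\ne 0$ for all $i\in\mathcal P$, and suppose that $U\in\mathrm{SL}_{\mathcal P}(\mathbf m,\mathbb Z)$ and $V\in\mathrm{SL}_{\mathcal P}(\mathbf n,\mathbb Z)$ satisfy $UBV=B'$. Then $(U,V)\colon B\to B'$ is a positive equivalence: there are factorizations $U=E_k\cdots E_2E_1$ into basic elementary matrices $E_s\in\mathrm{SL}_{\mathcal P}(\mathbf m,\mathbb Z)$ and $V=F_1F_2\cdots F_l$ into basic elementary matrices $F_t\in\mathrm{SL}_{\mathcal P}(\mathbf n,\mathbb Z)$ such that one can pass from $B$ to $B'$ by applying these matrices one at a time, the $E_s$ from the left in the order $E_1,\dots,E_k$ and the $F_t$ from the right in the order $F_1,\dots,F_l$,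 in some interleaving of the two sequences, with the matrix obtained after each step lying in $\mathfrak M^+_{\mathcal P}(\mathbf m\times\mathbf n,\mathbb Z)$. -/

import Mathlib

namespace BlockMatrix

/-- Index set of `ℤ^{n_1} ⊕ ⋯ ⊕ ℤ^{n_N}`: the pair `⟨i, a⟩` is the `a`-th basis vector of the
`i`-th summand. Summands with `n i = 0` contribute no index. -/
abbrev Idx {N : ℕ} (n : Fin N → ℕ) : Type := Σ i : Fin N, Fin (n i)

/-- The group of all `m × n` integer block matrices, `m` and `n` being multiindices. -/
abbrev Mat {N : ℕ} (m n : Fin N → ℕ) : Type := Matrix (Idx m) (Idx n) ℤ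

/-- The block `B{i,j}`, the component from the `j`-th to the `i`-th summand. -/
def block {N : ℕ} {m n : Fin N → ℕ} (B : Mat m n) (i j : Fin N) :
    Matrix (Fin (m i)) (Fin (n j)) ℤ :=
  Matrix.of fun a b => B ⟨i, a⟩ ⟨j, b⟩

/-- `𝔐_𝒫(m × n, ℤ)`: a block `B{i,j}` may be nonzero only if `i ⪯ j`. -/
def MP {N : ℕ} (le : Fin N → Fin N → Prop) (m n : Fin N → ℕ) : Set (Mat m n) :=
  {B | ∀ i j, block B i j ≠ 0 → le i j}

/-- `GL_𝒫(n, ℤ)`: the automorphisms of `n` in the category with morphisms `MP`. -/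
def GLP {N : ℕ} (le : Fin N → Fin N → Prop) (n : Fin N → ℕ) : Set (Mat n n) :=
  {U | U ∈ MP le n n ∧ ∃ W ∈ MP le n n, U * W = 1 ∧ W * U = 1}

/-- `SL_𝒫(n, ℤ)`: all nonempty diagonal blocks have determinant `1`. -/
def SLP {N : ℕ} (le : Fin N → Fin N → Prop) (n : Fin N → ℕ) : Set (Mat n n) :=
  {U | U ∈ GLP le n ∧ ∀ i, n i ≠ 0 → (block U i i).det = 1}

/-- `A > 0`: every entry is positive. -/
def Pos {k l : ℕ} (A : Matrix (Fin k) (Fin l) ℤ) : Prop := ∀ a b, 0 < A a b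

/-- `D` is the Smith normal form of `A` over `ℤ`: `D = X A Y` with `X`, `Y` invertible over `ℤ`,
`D` is (rectangular) diagonal with nonnegative entries, and each diagonal entry divides the
next one. -/
def IsSmithNormalForm {k l : ℕ} (A D : Matrix (Fin k) (Fin l) ℤ) : Prop :=
  (∃ (X : (Matrix (Fin k) (Fin k) ℤ)ˣ) (Y : (Matrix (Fin l) (Fin l) ℤ)ˣ),
      (X : Matrix (Fin k) (Fin k) ℤ) * A * (Y : Matrix (Fin l) (Fin l) ℤ) = D) ∧
  (∀ (a : Fin k) (b : Fin l), (a : ℕ) ≠ (b : ℕ) → D a b = 0) ∧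
  (∀ a b, 0 ≤ D a b) ∧
  (∀ (a : Fin k) (b : Fin l) (a' : Fin k) (b' : Fin l),
      (a : ℕ) = (b : ℕ) → (a' : ℕ) = (a : ℕ) + 1 → (b' : ℕ) = (b : ℕ) + 1 → D a b ∣ D a' b')

/-- The Smith normal form of `A` has at least two entries equal to `1`. -/
def SmithHasTwoOnes {k l : ℕ} (A : Matrix (Fin k) (Fin l) ℤ) : Prop :=
  ∃ D : Matrix (Fin k) (Fin l) ℤ, IsSmithNormalForm A D ∧
    2 ≤ (Finset.univ.filter fun p : Fin k × Fin l => D p.1 p.2 = 1).card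

/-- `𝔐⁺_𝒫(m × n, ℤ)`. A block `B{i,j}` is nonempty iff `m i ≠ 0` and `n j ≠ 0`. -/
def MPplus {N : ℕ} (le : Fin N → Fin N → Prop) (m n : Fin N → ℕ) : Set (Mat m n) :=
  {B | B ∈ MP le m n ∧
    (∀ i j, le i j → m i ≠ 0 → n j ≠ 0 → Pos (block B i j)) ∧
    (∀ i, m i ≠ 0 → n i ≠ 0 →
      Pos (block B i i) ∧ SmithHasTwoOnes (block B i i) ∧ 3 ≤ n i ∧ 3 ≤ m i)}

/-- A basic elementary matrix: the identity except for one offdiagonal entry, which is `±1`. -/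
def IsBasicElementary {N : ℕ} {n : Fin N → ℕ} (E : Mat n n) : Prop :=
  ∃ a b : Idx n, a ≠ b ∧ ∃ c : ℤ, (c = 1 ∨ c = -1) ∧ E = Matrix.transvection a b c

/-- `PositiveChain le B U V`: starting from `B` one can apply, one at a time, basic elementary
matrices of `SL_𝒫` on the left or on the right, such that the matrix is in `𝔐⁺_𝒫` at every step,
the left factors multiply up to `U` and the right factors multiply up to `V`. -/
inductive PositiveChain {N : ℕ} (le : Fin N → Fin N → Prop) {m n : Fin N → ℕ} (B : Mat m n) :
    Mat m m → Mat n n → Prop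
  | refl : B ∈ MPplus le m n → PositiveChain le B 1 1
  | left (U : Mat m m) (V : Mat n n) (E : Mat m m) :
      PositiveChain le B U V → IsBasicElementary E → E ∈ SLP le m →
      (E * U) * B * V ∈ MPplus le m n → PositiveChain le B (E * U) V
  | right (U : Mat m m) (V : Mat n n) (F : Mat n n) :
      PositiveChain le B U V → IsBasicElementary F → F ∈ SLP le n →
      U * B * (V * F) ∈ MPplus le m n → PositiveChain le B U (V * F)

/-- `(U, V) : B → B'` is an `SL_𝒫`-equivalence. -/
def IsSLPEquivalence {N : ℕ} (le : Fin N → Fin N → Prop) {m n : Fin N → ℕ}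
    (U : Mat m m) (V : Mat n n) (B B' : Mat m n) : Prop :=
  U ∈ SLP le m ∧ V ∈ SLP le n ∧ U * B * V = B'

/-- `(U, V) : B → B'` is a positive equivalence. -/
def IsPositiveEquivalence {N : ℕ} (le : Fin N → Fin N → Prop) {m n : Fin N → ℕ}
    (U : Mat m m) (V : Mat n n) (B B' : Mat m n) : Prop :=
  B ∈ MPplus le m n ∧ B' ∈ MPplus le m n ∧ IsSLPEquivalence le U V B B' ∧
    PositiveChain le B U V

end BlockMatrix

namespace BlockMatrix

open Matrix Relation

/-! The theorem is a connectedness statement. Call a pair `(U, V)` good if both factors lie in SL_𝒫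
and `U B V` is positive in all allowed positions; the remaining conditions of 𝔐⁺ are then automatic
(`MPplus_of_mem_goodSet`). Both `(1, 1)` and the given pair are good, so it suffices to join every
good pair to `(1, 1)` by elementary operations through good pairs.

Two tools do the joining. The first is a pivot: if some rows are positive and stay untouched, large
multiples of them can be added to the other rows, and any sequence of operations on those other rows
can then be performed with positivity at every stage (`rowConn_posSet_of_pivot`). The admissible
coefficients form an upper set of a lattice, which is connected because any two points lie below
their supremum. The second is `conn_of_fibres`: over a path in an auxiliary graph, with the points
over neighbouring vertices joined, all points over the path are joined. It is applied at three
levels.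

One vector: in dimension at least three the `U` of determinant 1 with `U v > 0` are connected
(`rowConn_posVec`). The auxiliary graph consists of matrices for which `U v` merely has a chosen
positive entry, the pivot; it is handled by Euclid's algorithm and by generating the stabiliser of a
basis vector.

One vector per block (`colConn_fullPos`): an element of SL_𝒫 is block diagonal times block
unipotent. The diagonal factor is moved block by block with the one-vector result. The unipotent
factor never changes a vector inside its own block, and it makes the entries in higher blocks as
large as needed.

Matrices (`goodConn_of_mem_goodSet`): a vertex is some `U` with a choice of one row of `U B` in each
nonempty block, having nonzero diagonal part. Over it lie the good pairs whose first component
arises from `U` by row operations fixing the chosen rows. Such a fibre is connected: the second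
level moves `V` while the chosen rows stay positive, and these serve as pivots for all other rows
(`goodConn_of_transversal`). Two ones in the Smith form give rank at least two, hence independent
rows in each diagonal block. Two independent vectors can be made positive by one matrix
(`exists_posVec_pair`), so fibres over independent choices meet. Any two choices are linked through
a third, and every elementary operation fixes some valid choice. -/

theorem reflTransGen_symm {α : Type*} {r : α → α → Prop} (hr : ∀ a b, r a b → r b a) {a b : α}
    (h : ReflTransGen r a b) : ReflTransGen r b a := by
  induction h with
  | refl => exact .refl
  | tail _ h ih => exact .head (hr _ _ h) ih

/-! ### Connectedness of upper sets in a lattice -/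

section Lattice

variable {ι : Type*} [DecidableEq ι]

/-- One step in the lattice `ℤ^ι`, in a direction from `J`, inside the set `S`. -/
def LatticeStep (J : Set ι) (S : Set (ι → ℤ)) (A A' : ι → ℤ) : Prop :=
  A ∈ S ∧ A' ∈ S ∧ ∃ i ∈ J, ∃ c : ℤ, (c = 1 ∨ c = -1) ∧ A' = A + Pi.single i c

theorem LatticeStep.symm {J : Set ι} {S : Set (ι → ℤ)} {A A' : ι → ℤ}
    (h : LatticeStep J S A A') : LatticeStep J S A' A := by
  obtain ⟨h1, h2, i, hi, c, hc, rfl⟩ := h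
  refine ⟨h2, h1, i, hi, -c, by omega, ?_⟩
  rw [Pi.single_neg]; abel

theorem latticeStep_up [Fintype ι] {J : Set ι} {S : Set (ι → ℤ)}
    (hS : ∀ A ∈ S, ∀ i ∈ J, A + Pi.single i 1 ∈ S) {A A' : ι → ℤ} (hA : A ∈ S)
    (hle : A ≤ A') (hJ : ∀ i, i ∉ J → A i = A' i) :
    A' ∈ S ∧ ReflTransGen (LatticeStep J S) A A' := by
  induction hk : ∑ i, (A' i - A i).toNat using Nat.strong_induction_on generalizing A with
  | _ k ih =>
    by_cases hEq : A = A'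
    · subst hEq; exact ⟨hA, .refl⟩
    · obtain ⟨i, hi⟩ : ∃ i, A i ≠ A' i := by
        by_contra! h; exact hEq (funext h)
      have hiJ : i ∈ J := by by_contra h; exact hi (hJ i h)
      have hlt : A i < A' i := lt_of_le_of_ne (hle i) hi
      have hA2 := hS A hA i hiJ
      have hval : ∀ j, (A + Pi.single i 1 : ι → ℤ) j = if j = i then A i + 1 else A j := by
        intro j
        by_cases hj : j = i
        · subst hj; simp
        · simp [hj]
      obtain ⟨h1, h2⟩ := ih (∑ j, (A' j - (A + Pi.single i 1 : ι → ℤ) j).toNat) (by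
        rw [← hk]
        apply Finset.sum_lt_sum
        · intro j _
          rw [hval]
          split_ifs with h
          · subst h; omega
          · exact le_rfl
        · refine ⟨i, Finset.mem_univ _, ?_⟩
          rw [hval, if_pos rfl]; omega) hA2 (by
            intro j
            rw [hval]
            split_ifs with h
            · subst h; exact hlt
            · exact hle j) (by
            intro j hj
            rw [hval, if_neg (by rintro rfl; exact hj hiJ), hJ j hj]) rfl
      exact ⟨h1, .head ⟨hA, hA2, i, hiJ, 1, Or.inl rfl, rfl⟩ h2⟩

/-- An upper set of `ℤ^ι` is connected under unit steps. -/
theorem latticeStep_connected [Fintype ι] {J : Set ι} {S : Set (ι → ℤ)}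
    (hS : ∀ A ∈ S, ∀ i ∈ J, A + Pi.single i 1 ∈ S) {A A' : ι → ℤ} (hA : A ∈ S) (hA' : A' ∈ S)
    (hJ : ∀ i, i ∉ J → A i = A' i) :
    ReflTransGen (LatticeStep J S) A A' := by
  -- Both points climb to their supremum, and the second climb is reversed.
  have h1 := (latticeStep_up hS hA (A' := A ⊔ A') le_sup_left
    (fun i hi => by simp [hJ i hi])).2
  have h2 := (latticeStep_up hS hA' (A' := A ⊔ A') le_sup_right
    (fun i hi => by simp [hJ i hi])).2
  exact h1.trans (reflTransGen_symm (fun _ _ h => h.symm) h2)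

end Lattice

theorem exists_int_bound {κ : Type*} [Finite κ] (f : κ → ℤ) : ∃ K : ℤ, 0 ≤ K ∧ ∀ z, |f z| ≤ K := by
  obtain ⟨K, hK⟩ := (Set.finite_range fun z => |f z|).bddAbove
  exact ⟨max K 0, le_max_right _ _, fun z => le_max_of_le_left (hK ⟨z, rfl⟩)⟩

/-! ### Elementary row and column operations inside a set -/

section Steps

variable {ι : Type*} [Fintype ι] [DecidableEq ι]

/-- Multiplication from the left by a basic elementary matrix with offdiagonal position allowed
by `r`, inside the set `S`. -/
def RowStep (r : ι → ι → Prop) (S : Set (Matrix ι ι ℤ)) (U U' : Matrix ι ι ℤ) : Prop :=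
  U ∈ S ∧ U' ∈ S ∧ ∃ x y, x ≠ y ∧ r x y ∧ ∃ c : ℤ, (c = 1 ∨ c = -1) ∧ U' = transvection x y c * U

/-- Multiplication from the right by a basic elementary matrix with offdiagonal position allowed
by `r`, inside the set `S`. -/
def ColStep (r : ι → ι → Prop) (S : Set (Matrix ι ι ℤ)) (U U' : Matrix ι ι ℤ) : Prop :=
  U ∈ S ∧ U' ∈ S ∧ ∃ x y, x ≠ y ∧ r x y ∧ ∃ c : ℤ, (c = 1 ∨ c = -1) ∧ U' = U * transvection x y c

abbrev RowConn (r : ι → ι → Prop) (S : Set (Matrix ι ι ℤ)) := ReflTransGen (RowStep r S)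

abbrev ColConn (r : ι → ι → Prop) (S : Set (Matrix ι ι ℤ)) := ReflTransGen (ColStep r S)

variable {r r' : ι → ι → Prop} {S S' : Set (Matrix ι ι ℤ)} {U U' : Matrix ι ι ℤ}

theorem RowStep.symm (h : RowStep r S U U') : RowStep r S U' U := by
  obtain ⟨h1, h2, x, y, hxy, hr, c, hc, rfl⟩ := h
  refine ⟨h2, h1, x, y, hxy, hr, -c, by omega, ?_⟩
  rw [← Matrix.mul_assoc, transvection_mul_transvection_same _ _ hxy]; simp

theorem ColStep.symm (h : ColStep r S U U') : ColStep r S U' U := by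
  obtain ⟨h1, h2, x, y, hxy, hr, c, hc, rfl⟩ := h
  refine ⟨h2, h1, x, y, hxy, hr, -c, by omega, ?_⟩
  rw [Matrix.mul_assoc, transvection_mul_transvection_same _ _ hxy]; simp

theorem rowConn_symm (h : RowConn r S U U') : RowConn r S U' U :=
  reflTransGen_symm (fun _ _ h => h.symm) h

theorem colConn_symm (h : ColConn r S U U') : ColConn r S U' U :=
  reflTransGen_symm (fun _ _ h => h.symm) h

theorem rowConn_mono (hr : ∀ x y, r x y → r' x y) (hS : S ⊆ S') (h : RowConn r S U U') :
    RowConn r' S' U U' :=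
  ReflTransGen.mono (fun _ _ ⟨h1, h2, x, y, hxy, h3, h4⟩ =>
    ⟨hS h1, hS h2, x, y, hxy, hr x y h3, h4⟩) _ _ h

theorem colConn_mono (hr : ∀ x y, r x y → r' x y) (hS : S ⊆ S') (h : ColConn r S U U') :
    ColConn r' S' U U' :=
  ReflTransGen.mono (fun _ _ ⟨h1, h2, x, y, hxy, h3, h4⟩ =>
    ⟨hS h1, hS h2, x, y, hxy, hr x y h3, h4⟩) _ _ h

/-- A property preserved by the steps holds all along the path. -/
theorem rowConn_restrict {I : Set (Matrix ι ι ℤ)}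
    (hI : ∀ U ∈ I, ∀ x y, x ≠ y → r x y → ∀ c : ℤ, transvection x y c * U ∈ I)
    (h : RowConn r S U U') (hU : U ∈ I) : RowConn r (S ∩ I) U U' ∧ U' ∈ I := by
  induction h with
  | refl => exact ⟨.refl, hU⟩
  | tail _ hs ih =>
    obtain ⟨h1, h2, x, y, hxy, hr, c, hc, rfl⟩ := hs
    have h3 := hI _ ih.2 x y hxy hr c
    exact ⟨ih.1.tail ⟨⟨h1, ih.2⟩, ⟨h2, h3⟩, x, y, hxy, hr, c, hc, rfl⟩, h3⟩

theorem transvection_mul_apply {κ : Type*} (x y : ι) (c : ℤ) (M : Matrix ι κ ℤ)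
    (a : ι) (z : κ) :
    (transvection x y c * M) a z = M a z + if a = x then c * M y z else 0 := by
  split_ifs with h
  · subst h
    simp [transvection, Matrix.add_mul, Matrix.single_mul_apply_same]
  · simp [transvection, Matrix.add_mul, Matrix.single_mul_apply_of_ne _ _ _ _ _ h]

theorem mul_transvection_apply {κ : Type*} (x y : ι) (c : ℤ) (M : Matrix κ ι ℤ)
    (z : κ) (a : ι) :
    (M * transvection x y c) z a = M z a + if a = y then c * M z x else 0 := by
  split_ifs with h
  · subst h
    simp [transvection, Matrix.mul_add, Matrix.mul_single_apply_same, mul_comm]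
  · simp [transvection, Matrix.mul_add, Matrix.mul_single_apply_of_ne _ _ _ _ _ h]

theorem transvection_mul_mulVec (x y : ι) (c : ℤ) (U : Matrix ι ι ℤ) (v : ι → ℤ) (a : ι) :
    ((transvection x y c * U) *ᵥ v) a = (U *ᵥ v) a + if a = x then c * (U *ᵥ v) y else 0 := by
  have := transvection_mul_apply x y c (Matrix.replicateCol Unit (U *ᵥ v)) a ()
  rw [Matrix.replicateCol_apply, Matrix.replicateCol_apply] at this
  rw [← this, ← Matrix.mulVec_mulVec]
  rfl

end Steps

/-! ### Positive pivot rows -/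

section Pivot

/-- The matrix that adds `f (x, y)` times row `y` to row `x`. -/
def shift {ι : Type*} [DecidableEq ι] (f : ι × ι → ℤ) : Matrix ι ι ℤ :=
  1 + Matrix.of fun x y => f (x, y)

theorem shift_zero {ι : Type*} [DecidableEq ι] : shift (0 : ι × ι → ℤ) = 1 := by
  ext a b; simp [shift]

variable {ι : Type*} [Fintype ι] [DecidableEq ι] {κ : Type*}

/-- The positions in which multiples of rows of `R` are added to the other rows. -/
def shiftSet (r : ι → ι → Prop) (R : Set ι) : Set (ι × ι) :=
  {p | r p.1 p.2 ∧ p.1 ∉ R ∧ p.2 ∈ R}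

/-- Rows in `R` are never altered, so successive additions commute and their coefficients simply add
up: elementary operations become unit steps in a lattice. The hypothesis `hT` says that the
admissible coefficients form an upper set. -/
theorem shift_rowConn {r : ι → ι → Prop} {R : Set ι} {T : Set (Matrix ι ι ℤ)} {U : Matrix ι ι ℤ}
    (hT : ∀ f : ι × ι → ℤ, (∀ p, p ∉ shiftSet r R → f p = 0) →
      shift f * U ∈ T → ∀ p ∈ shiftSet r R,
      shift (f + Pi.single p 1) * U ∈ T)
    {f g : ι × ι → ℤ} (hf : ∀ p, p ∉ shiftSet r R → f p = 0) (hg : ∀ p, p ∉ shiftSet r R → g p = 0)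
    (hfT : shift f * U ∈ T)
    (hgT : shift g * U ∈ T) :
    RowConn (fun x y => r x y ∧ x ∉ R) T (shift f * U)
      (shift g * U) := by
  have key := latticeStep_connected (J := shiftSet r R)
    (S := {f | (∀ p, p ∉ shiftSet r R → f p = 0) ∧ shift f * U ∈ T})
    (fun A hA p hp => ⟨fun q hq => by
      rw [Pi.add_apply, hA.1 q hq, Pi.single_eq_of_ne (by rintro rfl; exact hq hp), add_zero],
      hT A hA.1 hA.2 p hp⟩) ⟨hf, hfT⟩ ⟨hg, hgT⟩ (fun i hi => by rw [hf i hi, hg i hi])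
  refine ReflTransGen.lift (fun f : ι × ι → ℤ => shift f * U) ?_ _ _ key
  rintro A A' ⟨hA, hA', ⟨x, y⟩, hp, c, hc, rfl⟩
  have hne : x ≠ y := fun h => hp.2.1 (by simpa [h] using hp.2.2)
  refine ⟨hA.2, hA'.2, x, y, hne, ⟨hp.1, hp.2.1⟩, c, hc, ?_⟩
  rw [← Matrix.mul_assoc]
  refine congrArg (· * U) ?_
  ext a b
  have hz : A (y, b) = 0 := hA.1 _ (fun h => h.2.1 hp.2.2)
  have h1 : (transvection x y c : Matrix ι ι ℤ) a b
      = (1 : Matrix ι ι ℤ) a b + if a = x then c * (1 : Matrix ι ι ℤ) y b else 0 := by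
    rw [← transvection_mul_apply, Matrix.mul_one]
  rw [transvection_mul_apply]
  simp only [shift, Matrix.add_apply, Matrix.of_apply, Pi.add_apply, hz, Matrix.one_apply,
    Pi.single_apply, Prod.mk.injEq]
  by_cases ha : a = x <;> by_cases hb : b = y
  · subst ha hb; simp; ring
  · simp [ha, hb, Ne.symm hb]
  · simp [ha]
  · simp [ha]

/-- The matrices `U` such that `U * C` is positive in the positions given by `s`. -/
def posSet (s : ι → κ → Prop) (C : Matrix ι κ ℤ) : Set (Matrix ι ι ℤ) :=
  {U | ∀ x z, s x z → 0 < (U * C) x z}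

/-- The matrices `U` such that `U * C` is supported in the positions given by `s`. -/
def suppSet (s : ι → κ → Prop) (C : Matrix ι κ ℤ) : Set (Matrix ι ι ℤ) :=
  {U | ∀ x z, (U * C) x z ≠ 0 → s x z}

theorem transvection_mem_suppSet {r : ι → ι → Prop} {s : ι → κ → Prop} {C : Matrix ι κ ℤ}
    (hrs : ∀ x y z, r x y → s y z → s x z) {U : Matrix ι ι ℤ} (hU : U ∈ suppSet s C)
    {x y : ι} (hxy : r x y) (c : ℤ) : transvection x y c * U ∈ suppSet s C := by
  intro a z h
  rw [Matrix.mul_assoc, transvection_mul_apply] at h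
  by_contra hs
  have h1 : (U * C) a z = 0 := by by_contra h1; exact hs (hU _ _ h1)
  split_ifs at h with hax
  · subst hax
    have h2 : (U * C) y z = 0 := by by_contra h2; exact hs (hrs _ _ _ hxy (hU _ _ h2))
    rw [h1, h2] at h; simp at h
  · rw [h1] at h; simp at h

variable {r : ι → ι → Prop} {s : ι → κ → Prop} {C : Matrix ι κ ℤ} {R : Set ι} {U U' : Matrix ι ι ℤ}

theorem shift_mul_apply (f : ι × ι → ℤ) (x : ι) (z : κ) :
    (shift f * U * C) x z
      = (U * C) x z + ∑ y, f (x, y) * (U * C) y z := by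
  rw [shift, Matrix.mul_assoc, Matrix.add_mul, Matrix.one_mul, Matrix.add_apply, Matrix.mul_apply]
  rfl

theorem shift_single_mul_apply (f : ι × ι → ℤ) (p : ι × ι) (k : ℤ) (x : ι) (z : κ) :
    (shift (f + Pi.single p k : ι × ι → ℤ) * U * C : Matrix ι κ ℤ) x z
      = (shift f * U * C) x z
        + if x = p.1 then k * (U * C) p.2 z else 0 := by
  rw [shift_mul_apply, shift_mul_apply, add_assoc]
  congr 1
  simp only [Pi.add_apply, add_mul, Finset.sum_add_distrib]
  congr 1
  obtain ⟨a, b⟩ := p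
  by_cases h : x = a
  · subst h; simp [Pi.single_apply]
  · simp [h]

/-- If the rows in `R` are positive, then they can be added to the other rows to make these
positive, too. -/
theorem exists_rowConn_posSet [Finite κ]
    (hR : ∀ x, x ∉ R → ∃ y ∈ R, r x y ∧ ∀ z, s x z → s y z)
    (hpos : ∀ y ∈ R, ∀ z, s y z → 0 < (U * C) y z) :
    ∃ U', RowConn (fun x y => r x y ∧ x ∉ R) Set.univ U U' ∧ U' ∈ posSet s C := by
  classical
  choose! g hgR hgr hgs using hR
  obtain ⟨K, hK0, hK⟩ := exists_int_bound fun p : ι × κ => (U * C) p.1 p.2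
  -- All entries are at least `-K` and the required pivot entries are at least 1, so `K + 1` copies
  -- of the pivot row suffice.
  let f : ι × ι → ℤ := fun p => if p.1 ∉ R ∧ p.2 = g p.1 then K + 1 else 0
  have hf : ∀ p, p ∉ shiftSet r R → f p = 0 := by
    rintro ⟨x, y⟩ hp
    refine if_neg ?_
    rintro ⟨h1, h2⟩
    simp only at h1 h2
    subst h2
    exact hp ⟨hgr x h1, h1, hgR x h1⟩
  have h := shift_rowConn (r := r) (R := R) (T := Set.univ) (U := U) (fun _ _ _ _ _ => trivial)
    (f := 0) (g := f) (fun _ _ => rfl) hf trivial trivial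
  rw [shift_zero, Matrix.one_mul] at h
  refine ⟨_, h, ?_⟩
  intro x z hxz
  rw [shift_mul_apply]
  by_cases hx : x ∈ R
  · have : ∀ y, f (x, y) = 0 := fun y => hf _ (fun h => h.2.1 hx)
    simp [this, hpos x hx z hxz]
  · have : ∑ y, f (x, y) * (U * C) y z = (K + 1) * (U * C) (g x) z := by
      simp [f, hx]
    rw [this]
    have h1 := hK (x, z)
    have h2 := hpos _ (hgR x hx) z (hgs x hx z hxz)
    have h3 := abs_le.1 h1
    simp only at h3
    nlinarith

/-- If `U` and `U'` are positive and differ by row operations that leave the positive rows in `R`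
unchanged, then one can pass from `U` to `U'` through positive matrices. -/
theorem rowConn_posSet_of_pivot [Finite κ]
    (htrans : ∀ x y z, r x y → r y z → r x z)
    (hrs : ∀ x y z, r x y → s y z → s x z)
    (hR : ∀ x, x ∉ R → ∃ y ∈ R, r x y ∧ ∀ z, s x z → s y z)
    (hsupp : U ∈ suppSet s C) (hU : U ∈ posSet s C) (hU' : U' ∈ posSet s C)
    (h : RowConn (fun x y => r x y ∧ x ∉ R) Set.univ U U') :
    RowConn r (posSet s C) U U' := by
  have hup : ∀ V : Matrix ι ι ℤ, V ∈ suppSet s C → (∀ y ∈ R, ∀ z, s y z → 0 < (V * C) y z) →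
      ∀ f : ι × ι → ℤ, (∀ p, p ∉ shiftSet r R → f p = 0) →
      shift f * V ∈ posSet s C → ∀ p ∈ shiftSet r R,
      shift (f + Pi.single p 1) * V ∈ posSet s C := by
    intro V hV hVR f _ hfV p hp x z hxz
    rw [shift_single_mul_apply]
    have h1 := hfV x z hxz
    split_ifs with hx
    · have h2 : 0 ≤ (V * C) p.2 z := by
        by_cases hz : (V * C) p.2 z = 0
        · exact hz.ge
        · exact (hVR _ hp.2.2 z (hV _ _ hz)).le
      linarith
    · simpa using h1
  -- Along the given path positivity may fail for `V` itself. The invariant is that some shift of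
  -- `V` by rows in `R` is positive and already reached through positive matrices.
  have main : ∀ V, RowConn (fun x y => r x y ∧ x ∉ R) Set.univ U V →
      V ∈ suppSet s C ∧ (∀ y ∈ R, ∀ z, s y z → 0 < (V * C) y z) ∧
      ∃ f : ι × ι → ℤ, (∀ p, p ∉ shiftSet r R → f p = 0) ∧ shift f * V ∈ posSet s C ∧
        RowConn r (posSet s C) U (shift f * V) := by
    intro V hV
    induction hV with
    | refl =>
      refine ⟨hsupp, fun y _ z hz => hU y z hz, 0, fun _ _ => rfl, ?_⟩
      rw [shift_zero, Matrix.one_mul]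
      exact ⟨hU, .refl⟩
    | @tail V _ _ hs ih =>
      obtain ⟨-, -, x, y, hxy, ⟨hr, hxR⟩, c, hc, rfl⟩ := hs
      obtain ⟨hV, hVR, f, hf, hfV, hconn⟩ := ih
      refine ⟨transvection_mem_suppSet hrs hV hr c, fun a ha z hz => ?_, ?_⟩
      · rw [Matrix.mul_assoc, transvection_mul_apply, if_neg (by rintro rfl; exact hxR ha), add_zero]
        exact hVR a ha z hz
      obtain ⟨g, hgR, hgr, hgs⟩ := hR x hxR
      -- Raising row `x` by `K` times its pivot row makes it exceed row `y` in absolute value, so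
      -- row `y` can be added or subtracted safely.
      obtain ⟨K, hK0, hK⟩ := exists_int_bound fun z =>
        (shift f * V * C) y z
      set f2 : ι × ι → ℤ := f + Pi.single (x, g) K with hf2
      have hf2s : ∀ p, p ∉ shiftSet r R → f2 p = 0 := by
        intro p hp
        rw [hf2, Pi.add_apply, hf p hp, Pi.single_eq_of_ne, add_zero]
        rintro rfl
        exact hp ⟨hgr, hxR, hgR⟩
      have hval : ∀ a z, (shift f2 * V * C) a z
          = (shift f * V * C) a z
            + if a = x then K * (V * C) g z else 0 := fun a z =>
        shift_single_mul_apply f (x, g) K a z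
      have hf2V : shift f2 * V ∈ posSet s C := by
        intro a z haz
        rw [hval]
        have h1 := hfV a z haz
        split_ifs with hax
        · subst hax
          have h2 := hVR g hgR z (hgs z haz)
          have := mul_nonneg hK0 h2.le
          linarith
        · linarith
      have hc2 := shift_rowConn (hup V hV hVR) hf hf2s hfV hf2V
      -- Moving the transvection past the shift: row `x` also receives `c` times the pivot rows
      -- contained in row `y`.
      let f3 : ι × ι → ℤ := fun p => f2 p + if p.1 = x then c * f2 (y, p.2) else 0
      have hf3s : ∀ p, p ∉ shiftSet r R → f3 p = 0 := by
        rintro ⟨a, b⟩ hp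
        simp only [f3]
        rw [hf2s _ hp, zero_add]
        split_ifs with hax
        · subst hax
          rw [hf2s (y, b), mul_zero]
          rintro ⟨h1, h2, h3⟩
          exact hp ⟨htrans _ _ _ hr h1, hxR, h3⟩
        · rfl
      have hEq : transvection x y c * (shift f2 * V)
          = shift f3 * (transvection x y c * V) := by
        rw [← Matrix.mul_assoc, ← Matrix.mul_assoc]
        congr 1
        ext a b
        rw [transvection_mul_apply, mul_transvection_apply]
        simp only [shift, Matrix.add_apply, Matrix.of_apply, f3]
        have h1 : f2 (a, x) = 0 := hf2s _ (fun h => hxR h.2.2)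
        have h2 : f2 (y, x) = 0 := hf2s _ (fun h => hxR h.2.2)
        rw [h1, h2]
        simp only [Matrix.one_apply]
        by_cases hax : a = x <;> by_cases hby : b = y
        · subst hax hby; simp; ring
        · simp [hax, hby, Ne.symm hby]; ring
        · simp [hax]
        · simp [hax]
      refine ⟨f3, hf3s, ?_⟩
      rw [← hEq]
      have hpos : transvection x y c * (shift f2 * V)
          ∈ posSet s C := by
        intro a z haz
        rw [Matrix.mul_assoc, transvection_mul_apply, hval y, if_neg (Ne.symm hxy), add_zero]
        split_ifs with hax
        · subst hax
          rw [hval, if_pos rfl]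
          have h1 := hfV a z haz
          have h2 := hVR g hgR z (hgs z haz)
          have h3 := abs_le.1 (hK z)
          rcases hc with rfl | rfl <;> nlinarith
        · rw [add_zero]; exact hf2V a z haz
      exact ⟨hpos, (hconn.trans (rowConn_mono (fun _ _ h => h.1) le_rfl hc2)).tail
        ⟨hf2V, hpos, x, y, hxy, hr, c, hc, rfl⟩⟩
  obtain ⟨hV, hVR, f, hf, hfV, hconn⟩ := main U' h
  have h0 : shift 0 * U' = U' := by rw [shift_zero, Matrix.one_mul]
  -- `U'` is itself positive, so the zero shift is admissible and the accumulated one can be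
  -- removed.
  have := shift_rowConn (hup U' hV hVR) (g := 0) hf (fun _ _ => rfl) hfV (by rwa [h0])
  rw [h0] at this
  exact hconn.trans (rowConn_mono (fun _ _ h => h.1) le_rfl this)

end Pivot

/-- If consecutive fibres are connected to each other, then all fibres along a path are. -/
theorem conn_of_fibres {α β : Type*} {conn : α → α → Prop} (htrans : ∀ a b c, conn a b → conn b c →
    conn a c) {F : β → Set α} {E : β → β → Prop} (hne : ∀ b b', E b b' → (F b').Nonempty)
    (hE : ∀ b b', E b b' → ∀ p ∈ F b, ∀ p' ∈ F b', conn p p') {b b' : β}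
    (h0 : ∀ p ∈ F b, ∀ p' ∈ F b, conn p p') (h : ReflTransGen E b b') :
    ∀ p ∈ F b, ∀ p' ∈ F b', conn p p' := by
  induction h with
  | refl => exact h0
  | tail h1 h2 ih =>
    intro p hp p' hp'
    -- An intermediate point is taken over the next-to-last vertex. Nonemptiness is known only at
    -- ends of edges, so a path of one edge is treated directly.
    rcases ReflTransGen.cases_tail h1 with rfl | ⟨d, -, hd⟩
    · exact hE _ _ h2 p hp p' hp'
    · obtain ⟨q, hq⟩ := hne _ _ hd
      exact htrans _ _ _ (ih p hp q hq) (hE _ _ h2 q hq p' hp')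

theorem transpose_transvection {ι : Type*} [DecidableEq ι] (x y : ι) (c : ℤ) :
    (transvection x y c)ᵀ = transvection y x c := by
  simp [transvection, Matrix.transpose_add]

/-- The matrices `U` such that the vector `U v` is positive. -/
def posVec {ι : Type*} [Fintype ι] (v : ι → ℤ) : Set (Matrix ι ι ℤ) := {U | ∀ x, 0 < (U *ᵥ v) x}

theorem posVec_eq_posSet {ι : Type*} [Fintype ι] (v : ι → ℤ) :
    posVec v = posSet (fun _ _ => True) (Matrix.replicateCol Unit v) := by
  ext U
  exact ⟨fun h x _ _ => h x, fun h x => h x () trivial⟩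

/-! ### Matrices of determinant 1 that make one vector positive -/

section Vector

variable {ι : Type*} [Fintype ι] [DecidableEq ι] {v : ι → ℤ} {U U' : Matrix ι ι ℤ}

theorem exists_rowConn_posVec {R : Set ι} (hne : R.Nonempty)
    (hpos : ∀ y ∈ R, 0 < (U *ᵥ v) y) :
    ∃ U', RowConn (fun x _ => x ∉ R) Set.univ U U' ∧ U' ∈ posVec v := by
  obtain ⟨U', h1, h2⟩ := exists_rowConn_posSet (r := fun _ _ => True) (s := fun _ _ => True)
    (C := Matrix.replicateCol Unit v) (R := R) (U := U)
    (fun x _ => ⟨hne.some, hne.some_mem, trivial, fun _ _ => trivial⟩)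
    (fun y hy _ _ => hpos y hy)
  exact ⟨U', rowConn_mono (fun _ _ h => h.2) le_rfl h1, by rwa [posVec_eq_posSet]⟩

theorem rowConn_posVec_of_pivot {c : ι} (hU : U ∈ posVec v) (hU' : U' ∈ posVec v)
    (h : RowConn (fun x _ => x ≠ c) Set.univ U U') :
    RowConn (fun _ _ => True) (posVec v) U U' := by
  rw [posVec_eq_posSet] at *
  exact rowConn_posSet_of_pivot (R := {c}) (fun _ _ _ _ _ => trivial) (fun _ _ _ _ _ => trivial)
    (fun x _ => ⟨c, rfl, trivial, fun _ _ => trivial⟩) (fun _ _ _ => trivial) hU hU'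
    (rowConn_mono (fun _ _ h => ⟨trivial, h⟩) le_rfl h)

theorem rowConn_transvection {r : ι → ι → Prop} {x y : ι} (hxy : x ≠ y) (hr : r x y) (k : ℤ)
    (U : Matrix ι ι ℤ) : RowConn r Set.univ U (transvection x y k * U) := by
  induction k using Int.induction_on with
  | zero => simp [ReflTransGen.refl]
  | succ i ih =>
    refine ih.tail ⟨trivial, trivial, x, y, hxy, hr, 1, Or.inl rfl, ?_⟩
    rw [← Matrix.mul_assoc, transvection_mul_transvection_same _ _ hxy, add_comm]
  | pred i ih =>
    refine ih.tail ⟨trivial, trivial, x, y, hxy, hr, -1, Or.inr rfl, ?_⟩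
    rw [← Matrix.mul_assoc, transvection_mul_transvection_same _ _ hxy, sub_eq_add_neg, add_comm]

theorem rowConn_det {r : ι → ι → Prop} {S : Set (Matrix ι ι ℤ)} (h : RowConn r S U U') :
    U'.det = U.det := by
  refine (rowConn_restrict (I := {X | X.det = U.det}) ?_ h rfl).2
  intro X hX x y hxy _ c
  simp only [Set.mem_ofPred_eq] at hX ⊢
  rw [Matrix.det_mul, det_transvection_of_ne _ _ hxy, one_mul, hX]

/-- Euclid's algorithm on the entries of `U v` in `J`, with a positive entry at every stage. -/
theorem exists_rowConn_single {J : Set ι} {o : ι} (ho : o ∈ J)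
    (h : ∃ x ∈ J, 0 < (U *ᵥ v) x) :
    ∃ U', RowConn (fun x y => x ∈ J ∧ y ∈ J) {U | ∃ x ∈ J, 0 < (U *ᵥ v) x} U U' ∧
      0 < (U' *ᵥ v) o ∧ ∀ x ∈ J, x ≠ o → (U' *ᵥ v) x = 0 := by
  induction hk : ∑ x, ((U *ᵥ v) x).natAbs using Nat.strong_induction_on generalizing U with
  | _ k ih =>
    have step : ∀ x ∈ J, ∀ y ∈ J, x ≠ y → ∀ c : ℤ, (c = 1 ∨ c = -1) →
        ((U *ᵥ v) x + c * (U *ᵥ v) y).natAbs < ((U *ᵥ v) x).natAbs →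
        (∃ a ∈ J, 0 < ((transvection x y c * U) *ᵥ v) a) →
        ∃ U', RowConn (fun x y => x ∈ J ∧ y ∈ J) {U | ∃ x ∈ J, 0 < (U *ᵥ v) x} U U' ∧
          0 < (U' *ᵥ v) o ∧ ∀ x ∈ J, x ≠ o → (U' *ᵥ v) x = 0 := by
      intro x hx y hy hxy c hc hlt hpos
      obtain ⟨U', h1, h2⟩ := ih _ (by
        rw [← hk]
        refine Finset.sum_lt_sum (fun a _ => ?_) ⟨x, Finset.mem_univ _, ?_⟩
        · rw [transvection_mul_mulVec]
          split_ifs with hax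
          · subst hax; exact hlt.le
          · simp
        · rw [transvection_mul_mulVec, if_pos rfl]; exact hlt) hpos rfl
      exact ⟨U', .head ⟨h, hpos, x, y, hxy, ⟨hx, hy⟩, c, hc, rfl⟩ h1, h2⟩
    obtain ⟨c, hcJ, hc⟩ := h
    -- Each branch lowers the sum of absolute values and names an entry that stays positive. When
    -- `c` is reduced by a positive `y` it may reach 0, but then `y` is the witness.
    by_cases hy : ∃ y ∈ J, y ≠ c ∧ (U *ᵥ v) y ≠ 0
    · obtain ⟨y, hyJ, hyc, hy0⟩ := hy
      rcases lt_or_gt_of_ne hy0 with hneg | hpos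
      · by_cases hlt : -(U *ᵥ v) y < (U *ᵥ v) c
        · refine step c hcJ y hyJ hyc.symm 1 (Or.inl rfl) (by omega) ⟨c, hcJ, ?_⟩
          rw [transvection_mul_mulVec, if_pos rfl]; omega
        · refine step y hyJ c hcJ hyc 1 (Or.inl rfl) (by omega) ⟨c, hcJ, ?_⟩
          rw [transvection_mul_mulVec, if_neg hyc.symm]; omega
      · by_cases hlt : (U *ᵥ v) y ≤ (U *ᵥ v) c
        · refine step c hcJ y hyJ hyc.symm (-1) (Or.inr rfl) (by omega) ⟨y, hyJ, ?_⟩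
          rw [transvection_mul_mulVec, if_neg hyc]; omega
        · refine step y hyJ c hcJ hyc (-1) (Or.inr rfl) (by omega) ⟨c, hcJ, ?_⟩
          rw [transvection_mul_mulVec, if_neg hyc.symm]; omega
    · push Not at hy
      by_cases hoc : o = c
      · subst hoc
        exact ⟨U, .refl, hc, hy⟩
      · have ho0 := hy o ho hoc
        -- The only nonzero entry in `J` sits at `c`; it is copied to `o` and then cleared at `c`.
        have h1 : ∃ x ∈ J, 0 < ((transvection o c 1 * U) *ᵥ v) x := ⟨o, ho, by
          rw [transvection_mul_mulVec, if_pos rfl]; omega⟩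
        have h2 : 0 < ((transvection c o (-1) * (transvection o c 1 * U)) *ᵥ v) o := by
          rw [transvection_mul_mulVec, if_neg hoc, transvection_mul_mulVec, if_pos rfl]; omega
        refine ⟨transvection c o (-1) * (transvection o c 1 * U),
          .head ⟨⟨c, hcJ, hc⟩, h1, o, c, hoc, ⟨ho, hcJ⟩, 1, Or.inl rfl, rfl⟩
          (.head ⟨h1, ⟨o, ho, h2⟩, c, o, Ne.symm hoc, ⟨hcJ, ho⟩, -1, Or.inr rfl, rfl⟩ .refl),
          h2, ?_⟩
        intro x hx hxo
        rw [transvection_mul_mulVec, transvection_mul_mulVec, transvection_mul_mulVec,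
          if_neg hxo, if_pos rfl]
        split_ifs with hxc
        · subst hxc; omega
        · rw [hy x hx hxc]; simp

/-- The matrices whose columns with index in `D` are those of the identity matrix. -/
def colTriv (D : Finset ι) : Set (Matrix ι ι ℤ) :=
  {U | ∀ d ∈ D, ∀ x, U x d = (1 : Matrix ι ι ℤ) x d}

theorem transvection_mem_colTriv {D : Finset ι} (hU : U ∈ colTriv D) {x y : ι} (hy : y ∉ D)
    (c : ℤ) : transvection x y c * U ∈ colTriv D := by
  intro d hd a
  rw [transvection_mul_apply, hU d hd, hU d hd,
    Matrix.one_apply_ne (show y ≠ d by rintro rfl; exact hy hd)]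
  simp

/-- Removing from the basis vector at `o` the part of column `o` that lies in `D` gives a vector
that `U` sends to `U o o` times the basis vector. Applying the adjugate, which is the inverse,
exhibits 1 as a multiple of `U o o`. -/
theorem dvd_one_of_colTriv {D : Finset ι} (hU : U ∈ colTriv D) (hdet : U.det = 1) {o : ι}
    (ho : o ∉ D) (h : ∀ x, x ∉ D → x ≠ o → U x o = 0) : U o o ∣ 1 := by
  let f : ι → ℤ := fun y => if y ∈ D then U y o else 0
  have h1 : U *ᵥ (Pi.single o 1 - f) = U o o • Pi.single o 1 := by
    ext x
    have h2 : (U *ᵥ f) x = f x := by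
      have : ∀ y, U x y * f y = (1 : Matrix ι ι ℤ) x y * f y := by
        intro y
        by_cases hy : y ∈ D
        · rw [hU y hy]
        · simp [f, hy]
      calc (U *ᵥ f) x = ∑ y, U x y * f y := rfl
        _ = ((1 : Matrix ι ι ℤ) *ᵥ f) x := Finset.sum_congr rfl fun y _ => this y
        _ = f x := by rw [Matrix.one_mulVec]
    rw [Matrix.mulVec_sub, Pi.sub_apply, h2, Matrix.mulVec_single_one]
    by_cases hx : x = o
    · subst hx; simp [f, ho]
    · by_cases hxD : x ∈ D
      · simp [f, hxD, hx]
      · simp [f, hxD, hx, h x hxD hx]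
  have h3 := congrArg (fun w => (U.adjugate *ᵥ w) o) h1
  simp only [Matrix.mulVec_mulVec, Matrix.adjugate_mul, hdet, one_smul, Matrix.one_mulVec,
    Matrix.mulVec_smul, Pi.smul_apply, smul_eq_mul, Pi.sub_apply, Pi.single_eq_same] at h3
  have h4 : f o = 0 := if_neg ho
  rw [h4, sub_zero] at h3
  exact ⟨_, h3⟩

/-- Matrices of determinant `1` are products of basic elementary matrices; if some columns are
those of the identity matrix, then this is so at every stage. -/
theorem rowConn_one_of_colTriv {D : Finset ι} (hdet : U.det = 1) (hD : U ∈ colTriv D) :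
    RowConn (fun _ y => y ∉ D) Set.univ U 1 := by
  induction hk : Dᶜ.card using Nat.strong_induction_on generalizing D U with
  | _ k ih =>
    by_cases hall : ∀ o, o ∈ D
    · have : U = 1 := by
        ext x y; exact hD y (hall y) x
      rw [this]
    push Not at hall
    obtain ⟨o, ho⟩ := hall
    have hcol : ∀ (X : Matrix ι ι ℤ) x, (X *ᵥ Pi.single o 1) x = X x o := by
      intro X x; simp
    have h1 : ∃ U2, RowConn (fun x y => x ∉ D ∧ y ∉ D) Set.univ U U2 ∧
        (∀ x, x ∉ D → x ≠ o → U2 x o = 0) ∧ ((∃ z, z ∉ D ∧ z ≠ o) → 0 < U2 o o) := by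
      -- With a second row outside `D` the entry at `o` can be made positive by Euclid's algorithm.
      -- If `o` is the only such row, its sign is settled below by the determinant.
      by_cases hz : ∃ z, z ∉ D ∧ z ≠ o
      · obtain ⟨U1, hc1, hp1⟩ : ∃ U1, RowConn (fun x y => x ∉ D ∧ y ∉ D) Set.univ U U1 ∧
            ∃ x, x ∉ D ∧ 0 < U1 x o := by
          by_cases hp : ∃ x, x ∉ D ∧ 0 < U x o
          · exact ⟨U, .refl, hp⟩
          push Not at hp
          obtain ⟨x, hx, hx0⟩ : ∃ x, x ∉ D ∧ U x o ≠ 0 := by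
            by_contra! hall
            have := dvd_one_of_colTriv hD hdet ho (fun x hx _ => hall x hx)
            rw [hall o ho] at this
            omega
          obtain ⟨y, hy, hyx⟩ : ∃ y, y ∉ D ∧ y ≠ x := by
            obtain ⟨z, hz, hzo⟩ := hz
            by_cases hxo : x = o
            · exact ⟨z, hz, hxo ▸ hzo⟩
            · exact ⟨o, ho, Ne.symm hxo⟩
          -- Here `U x o ≤ -1` and `U y o ≤ 0`, so the new entry is at least `U y o - (U y o - 1) =
          -- 1`.
          refine ⟨transvection y x (U y o - 1) * U,
            rowConn_transvection hyx ⟨hy, hx⟩ _ _, y, hy, ?_⟩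
          rw [transvection_mul_apply, if_pos rfl]
          have := hp x hx
          have := hp y hy
          have : U x o ≤ -1 := by omega
          nlinarith
        obtain ⟨U2, hc2, h2, h3⟩ := exists_rowConn_single (U := U1) (v := Pi.single o 1)
          (J := {x | x ∉ D}) (o := o) ho (by simpa [hcol] using hp1)
        rw [hcol] at h2
        refine ⟨U2, hc1.trans (rowConn_mono (fun _ _ h => h) (Set.subset_univ _) hc2),
          fun x hx hxo => ?_, fun _ => h2⟩
        have := h3 x hx hxo
        rwa [hcol] at this
      · exact ⟨U, .refl, fun x hx hxo => absurd ⟨x, hx, hxo⟩ hz, fun h => absurd h hz⟩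
    obtain ⟨U2, hc2, hz2, hp2⟩ := h1
    have hD2 : U2 ∈ colTriv D := (rowConn_restrict (I := colTriv D)
      (fun X hX x y _ hr c => transvection_mem_colTriv hX hr.2 c) hc2 hD).2
    have hdet2 : U2.det = 1 := (rowConn_det hc2).trans hdet
    have hg := Int.isUnit_iff.1 (isUnit_of_dvd_one (dvd_one_of_colTriv hD2 hdet2 ho hz2))
    set g := U2 o o with hgdef
    have hgg : g * g = 1 := by rcases hg with h | h <;> rw [h] <;> rfl
    -- These multiples of row `o` clear column `o` in the rows of `D`; the unit `g` is its own
    -- inverse.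
    let f : ι × ι → ℤ := fun p => if p.2 = o ∧ p.1 ∈ D then -(U2 p.1 o) * g else 0
    have hc3 := shift_rowConn (r := fun _ y => y ∉ D) (R := {o}) (T := Set.univ) (U := U2)
      (fun _ _ _ _ _ => trivial) (f := 0) (g := f) (fun _ _ => rfl) (by
        rintro ⟨x, y⟩ hp
        refine if_neg ?_
        rintro ⟨h1, h2⟩
        simp only at h1 h2
        subst h1
        exact hp ⟨ho, fun h => ho ((Set.mem_singleton_iff.1 h) ▸ h2), rfl⟩) trivial trivial
    rw [shift_zero, Matrix.one_mul] at hc3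
    set U3 := shift f * U2 with hU3
    have hval : ∀ x z, U3 x z = U2 x z + if x ∈ D then -(U2 x o) * g * U2 o z else 0 := by
      intro x z
      have := shift_mul_apply (C := 1) (U := U2) f x z
      rw [Matrix.mul_one, Matrix.mul_one] at this
      rw [hU3, this]
      congr 1
      by_cases hx : x ∈ D <;> simp [f, hx]
    have hD3 : U3 ∈ colTriv D := (rowConn_restrict (I := colTriv D)
      (fun X hX x y _ hr c => transvection_mem_colTriv hX hr.1 c) hc3 hD2).2
    have hdet3 : U3.det = 1 := (rowConn_det hc3).trans hdet2
    have hcol3 : ∀ x, U3 x o = if x = o then g else 0 := by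
      intro x
      rw [hval]
      by_cases hxo : x = o
      · subst hxo; simp [ho, hgdef]
      · by_cases hx : x ∈ D
        · simp only [hx, hxo, if_true, if_false, ← hgdef]
          linear_combination (-U2 x o) * hgg
        · simp [hx, hxo, hz2 x hx hxo]
    have hg1 : g = 1 := by
      by_cases hz : ∃ z, z ∉ D ∧ z ≠ o
      · have := hp2 hz
        omega
      · push Not at hz
        have : U3 = Matrix.diagonal (fun x => if x = o then g else 1) := by
          ext x y
          by_cases hy : y ∈ D
          · rw [hD3 y hy]
            have hyo : y ≠ o := by rintro rfl; exact ho hy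
            by_cases hxy : x = y
            · subst hxy; simp [hyo]
            · simp [hxy]
          · rw [hz y hy, hcol3]
            by_cases hxo : x = o
            · subst hxo; simp
            · simp [hxo]
        rw [this, Matrix.det_diagonal, Finset.prod_ite_eq' ] at hdet3
        simpa using hdet3
    have hD4 : U3 ∈ colTriv (insert o D) := by
      intro d hd x
      rcases Finset.mem_insert.1 hd with rfl | hd
      · rw [hcol3, hg1, Matrix.one_apply]
      · exact hD3 d hd x
    have hfin := ih _ (by
      rw [← hk]
      refine Finset.card_lt_card (Finset.ssubset_iff_of_subset ?_ |>.2 ⟨o, by simpa using ho, by simp⟩)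
      exact Finset.compl_subset_compl.2 (Finset.subset_insert _ _)) hdet3 hD4 rfl
    exact ((rowConn_mono (fun _ _ h => h.2) le_rfl hc2).trans
      (rowConn_mono (fun _ _ h => h.1) le_rfl hc3)).trans
      (rowConn_mono (fun _ _ h h' => h (Finset.mem_insert_of_mem h')) le_rfl hfin)

/-- The matrices `U` such that the vector `U v` has a positive entry are connected. -/
theorem rowConn_somePos (hU : U.det = 1) (hU' : U'.det = 1) (h : ∃ x, 0 < (U *ᵥ v) x)
    (h' : ∃ x, 0 < (U' *ᵥ v) x) :
    RowConn (fun _ _ => True) {U | ∃ x, 0 < (U *ᵥ v) x} U U' := by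
  obtain ⟨o, -⟩ := id h
  have aux : ∀ {X : Matrix ι ι ℤ}, (∃ x, 0 < (X *ᵥ v) x) → ∃ X',
      RowConn (fun _ _ => True) {U | ∃ x, 0 < (U *ᵥ v) x} X X' ∧ 0 < (X' *ᵥ v) o ∧
      ∀ x, x ≠ o → (X' *ᵥ v) x = 0 := by
    intro X hX
    obtain ⟨X', h1, h2, h3⟩ := exists_rowConn_single (J := Set.univ) (o := o) trivial
      (by simpa using hX)
    exact ⟨X', rowConn_mono (fun _ _ _ => trivial) (fun _ h => by simpa using h) h1, h2,
      fun x hx => h3 x trivial hx⟩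
  obtain ⟨U1, hc, hp, hz⟩ := aux h
  obtain ⟨U1', hc', hp', hz'⟩ := aux h'
  refine hc.trans (ReflTransGen.trans ?_ (rowConn_symm hc'))
  have hd : U1.det = 1 := (rowConn_det hc).trans hU
  have hd' : U1'.det = 1 := (rowConn_det hc').trans hU'
  have hunit : IsUnit U1.det := by rw [hd]; exact isUnit_one
  -- Both reduced vectors are positive multiples of the basis vector at `o`, so the quotient `X`
  -- must fix that basis vector.
  set X := U1' * U1⁻¹ with hXdef
  have hX : X * U1 = U1' := by
    rw [hXdef, Matrix.mul_assoc, Matrix.nonsing_inv_mul _ hunit, Matrix.mul_one]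
  have hXdet : X.det = 1 := by
    have := congrArg Matrix.det hX
    rwa [Matrix.det_mul, hd, hd', mul_one] at this
  have hU1 : U1 *ᵥ v = (U1 *ᵥ v) o • Pi.single o 1 := by
    ext x
    by_cases hx : x = o
    · subst hx; simp
    · simp [hx, hz x hx]
  have hcol : ∀ x, (U1' *ᵥ v) x = (U1 *ᵥ v) o * X x o := by
    intro x
    rw [← hX, ← Matrix.mulVec_mulVec, hU1, Matrix.mulVec_smul]
    simp
  have hXz : ∀ x, x ≠ o → X x o = 0 := by
    intro x hx
    have := hcol x
    rw [hz' x hx] at this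
    rcases mul_eq_zero.1 this.symm with h | h
    · omega
    · exact h
  have hXo : X o o = 1 := by
    have h1 := Int.isUnit_iff.1 (isUnit_of_dvd_one (dvd_one_of_colTriv (D := ∅) (o := o)
      (fun _ h => by simp at h) hXdet (by simp) (fun x _ hx => hXz x hx)))
    have h2 := hcol o
    rcases h1 with h1 | h1
    · exact h1
    · rw [h1] at h2; omega
  have hXt : X ∈ colTriv {o} := by
    intro d hd x
    rw [Finset.mem_singleton.1 hd]
    by_cases hx : x = o
    · subst hx; simp [hXo]
    · simp [hx, hXz x hx]
  have hconn := rowConn_one_of_colTriv hXdet hXt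
  have hconn := (rowConn_restrict (I := colTriv {o})
      (fun X hX x y _ hr c => transvection_mem_colTriv hX hr c) hconn hXt).1
  -- Such `Y` fix the basis vector at `o`, so `Y * U1` and `U1` take `v` to the same vector.
  have hmem : ∀ Y ∈ colTriv {o}, ∃ x, 0 < ((Y * U1) *ᵥ v) x := by
    intro Y hY
    refine ⟨o, ?_⟩
    rw [← Matrix.mulVec_mulVec, hU1, Matrix.mulVec_smul]
    have := hY o (by simp) o
    simp only [Matrix.one_apply_eq] at this
    simpa [this] using hp
  have : RowConn (fun _ _ => True) {U | ∃ x, 0 < (U *ᵥ v) x} (X * U1) (1 * U1) :=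
    ReflTransGen.lift
    (r := RowStep (fun _ y => y ∉ ({o} : Finset ι)) (Set.univ ∩ colTriv {o}))
    (p := RowStep (fun _ _ => True) {U | ∃ x, 0 < (U *ᵥ v) x}) (fun Y => Y * U1) (by
    rintro Y Z ⟨hY, hZ, x, y, hxy, _, c, hc, rfl⟩
    exact ⟨hmem _ hY.2, hmem _ hZ.2, x, y, hxy, trivial, c, hc, Matrix.mul_assoc _ _ _⟩) _ _ hconn
  rw [hX, Matrix.one_mul] at this
  exact rowConn_symm this

/-- Steps between matrices `U` with a chosen positive entry of `U v`, which either change the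
choice or leave the chosen entry unchanged. -/
def PivotStep (v : ι → ℤ) (q q' : Matrix ι ι ℤ × ι) : Prop :=
  0 < (q.1 *ᵥ v) q.2 ∧ 0 < (q'.1 *ᵥ v) q'.2 ∧
    (q.1 = q'.1 ∨ (q.2 = q'.2 ∧ RowConn (fun x _ => x ≠ q.2) Set.univ q.1 q'.1))

/-- If a row other than the altered row `b` has a positive entry, it is the pivot. Otherwise `b` has
the only positive entry before and after. Then a third row `z` is made positive with copies of row
`b`, acts as pivot during the operation, and is restored with `b` as pivot. This is why three rows
are required. -/
theorem pivotStep_of_rowStep (h3 : ∀ a b : ι, ∃ z, z ≠ a ∧ z ≠ b)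
    (h : RowStep (fun _ _ => True) {U | ∃ x, 0 < (U *ᵥ v) x} U U') {c c' : ι}
    (hc : 0 < (U *ᵥ v) c) (hc' : 0 < (U' *ᵥ v) c') :
    ReflTransGen (PivotStep v) (U, c) (U', c') := by
  obtain ⟨-, -, b, a, hba, -, e, he, rfl⟩ := h
  have hval := transvection_mul_mulVec b a e U v
  by_cases hd : ∃ d, d ≠ b ∧ 0 < (U *ᵥ v) d
  · obtain ⟨d, hdb, hd⟩ := hd
    have hd' : 0 < ((transvection b a e * U) *ᵥ v) d := by
      rw [hval, if_neg hdb, add_zero]; exact hd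
    refine .head (b := (U, d)) ⟨hc, hd, Or.inl rfl⟩
      (.head (b := (transvection b a e * U, d)) ⟨hd, hd', Or.inr ⟨rfl, ?_⟩⟩
      (.single ⟨hd', hc', Or.inl rfl⟩))
    exact rowConn_transvection (r := fun x _ => x ≠ d) hba hdb.symm e U
  · push Not at hd
    have hcb : c = b := by
      by_contra h; have := hd c h; omega
    have hcb' : c' = b := by
      by_contra h
      have h1 := hd c' h
      rw [hval, if_neg h] at hc'; omega
    subst hcb hcb'
    obtain ⟨z, hza, hzb⟩ := h3 a c'
    -- The entry at `z` is at most 0 and the one at `b` at least 1, so adding `M` copies gives at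
    -- least 1.
    set M : ℤ := 1 - (U *ᵥ v) z with hM
    set U1 := transvection z c' M * U with hU1
    set U2 := transvection c' a e * U1 with hU2
    -- Row `z` received the old row `b`; the new one differs from it by `e` times row `a`, whence
    -- the correction.
    have hEq : U2 = transvection z a (-M * e) * (transvection z c' M *
        (transvection c' a e * U)) := by
      ext x y
      simp only [hU2, hU1, transvection_mul_apply]
      by_cases hxb : x = c'
      · subst hxb
        simp [Ne.symm hzb, Ne.symm hza]
      · by_cases hxz : x = z
        · subst hxz
          simp [hxb, Ne.symm hba, Ne.symm hza]; ring
        · simp [hxb, hxz]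
    have hv1 := transvection_mul_mulVec z c' M U v
    have hv2 := transvection_mul_mulVec c' a e U1 v
    have hz := hd z hzb
    have h1b : 0 < (U1 *ᵥ v) c' := by
      rw [hU1, hv1, if_neg (Ne.symm hzb), add_zero]; exact hc
    have h1z : 0 < (U1 *ᵥ v) z := by
      rw [hU1, hv1, if_pos rfl, hM]; nlinarith
    have h2z : 0 < (U2 *ᵥ v) z := by
      rw [hU2, hv2, if_neg hzb, add_zero]; exact h1z
    have h2b : 0 < (U2 *ᵥ v) c' := by
      rw [hU2, hv2, if_pos rfl, hU1, hv1, hv1, if_neg (Ne.symm hzb), if_neg (Ne.symm hza)]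
      rw [hval, if_pos rfl] at hc'
      simpa using hc'
    refine .head (b := (U1, c')) ⟨hc, h1b, Or.inr ⟨rfl, rowConn_transvection (r := fun x _ => x ≠ c') hzb hzb M U⟩⟩
      (.head (b := (U1, z)) ⟨h1b, h1z, Or.inl rfl⟩
      (.head (b := (U2, z)) ⟨h1z, h2z, Or.inr ⟨rfl, rowConn_transvection (r := fun x _ => x ≠ z) hba hzb.symm e U1⟩⟩
      (.head (b := (U2, c')) ⟨h2z, h2b, Or.inl rfl⟩
      (.single ⟨h2b, hc', Or.inr ⟨rfl, rowConn_symm ?_⟩⟩))))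
    simp only [hEq]
    exact (rowConn_transvection (r := fun x _ => x ≠ c') hzb hzb M _).trans
      (rowConn_transvection (r := fun x _ => x ≠ c') hza hzb (-M * e) _)

/-- If there are at least three rows, then the matrices `U` of determinant `1` such that `U v` is
positive are connected. -/
theorem rowConn_posVec (h3 : ∀ a b : ι, ∃ z, z ≠ a ∧ z ≠ b) (hdet : U.det = 1) (hdet' : U'.det = 1)
    (hU : U ∈ posVec v) (hU' : U' ∈ posVec v) : RowConn (fun _ _ => True) (posVec v) U U' := by
  by_cases hne : Nonempty ι
  swap
  · have : U = U' := by ext x; exact absurd ⟨x⟩ hne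
    rw [this]
  obtain ⟨o⟩ := hne
  let F : Matrix ι ι ℤ × ι → Set (Matrix ι ι ℤ) := fun q =>
    {p | p ∈ posVec v ∧ RowConn (fun x _ => x ≠ q.2) Set.univ q.1 p}
  have hrefl : ∀ q, ∀ p ∈ F q, ∀ p' ∈ F q, RowConn (fun _ _ => True) (posVec v) p p' :=
    fun q p hp p' hp' => rowConn_posVec_of_pivot hp.1 hp'.1 ((rowConn_symm hp.2).trans hp'.2)
  have hex : ∀ q : Matrix ι ι ℤ × ι, 0 < (q.1 *ᵥ v) q.2 → (F q).Nonempty := by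
    intro q hq
    obtain ⟨p, h1, h2⟩ := exists_rowConn_posVec (R := {q.2}) (Set.singleton_nonempty _)
      (fun y hy => by rw [Set.mem_singleton_iff.1 hy]; exact hq)
    exact ⟨p, h2, h1⟩
  have hpath : ReflTransGen (PivotStep v) (U, o) (U', o) := by
    have h1 := rowConn_somePos hdet hdet' ⟨o, hU o⟩ ⟨o, hU' o⟩
    have key : ∀ X, RowConn (fun _ _ => True) {U | ∃ x, 0 < (U *ᵥ v) x} U X →
        ∀ c, 0 < (X *ᵥ v) c → ReflTransGen (PivotStep v) (U, o) (X, c) := by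
      intro X hX
      induction hX with
      | refl => exact fun c hc => .single ⟨hU o, hc, Or.inl rfl⟩
      | tail _ hs ih =>
        intro c hc
        obtain ⟨d, hd⟩ := hs.1
        exact (ih d hd).trans (pivotStep_of_rowStep h3 hs hd hc)
    exact key U' h1 o (hU' o)
  refine conn_of_fibres (conn := RowConn (fun _ _ => True) (posVec v))
    (fun _ _ _ h h' => h.trans h') (F := F) (E := PivotStep v)
    (fun _ q' h => hex q' h.2.1) ?_ (hrefl _) hpath U ⟨hU, .refl⟩ U' ⟨hU', .refl⟩
  rintro ⟨X, c⟩ ⟨X', c'⟩ ⟨h1, h2, h⟩ p hp p' hp'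
  simp only at h1 h2 h
  have hcommon : (F (X, c) ∩ F (X', c')).Nonempty := by
    rcases h with rfl | ⟨rfl, h⟩
    -- Keeping both rows `c` and `c'` as pivots yields a point common to the two fibres.
    · obtain ⟨q, hq1, hq2⟩ := exists_rowConn_posVec (R := {c, c'}) (Set.insert_nonempty _ _)
        (U := X) (v := v) (by
          rintro y (rfl | rfl)
          · exact h1
          · exact h2)
      exact ⟨q, ⟨hq2, rowConn_mono (fun x _ h hx => h (Or.inl hx)) le_rfl hq1⟩,
        hq2, rowConn_mono (fun x _ h hx => h (Or.inr hx)) le_rfl hq1⟩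
    · obtain ⟨q, hq⟩ := hex (X, c) h1
      exact ⟨q, hq, hq.1, (rowConn_symm h).trans hq.2⟩
  obtain ⟨q, hq, hq'⟩ := hcommon
  exact (hrefl _ p hp q hq).trans (hrefl _ q hq' p' hp')

/-- Two linearly independent vectors can be made positive by the same matrix. -/
theorem exists_posVec_pair {u w : ι → ℤ} {a b : ι} (h : u a * w b ≠ u b * w a) :
    ∃ U : Matrix ι ι ℤ, U.det = 1 ∧ U ∈ posVec u ∧ U ∈ posVec w := by
  have hab : a ≠ b := by rintro rfl; exact h rfl
  obtain ⟨U0, hdet0, hp0⟩ : ∃ U0 : Matrix ι ι ℤ, U0.det = 1 ∧ ∃ x, 0 < (U0 *ᵥ u) x := by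
    by_cases hp : ∃ x, 0 < u x
    · exact ⟨1, Matrix.det_one, by simpa using hp⟩
    push Not at hp
    obtain ⟨x, y, hxy, hx⟩ : ∃ x y, y ≠ x ∧ u x ≠ 0 := by
      by_cases ha : u a = 0
      · refine ⟨b, a, hab, fun hb => h ?_⟩
        rw [ha, hb]; ring
      · exact ⟨a, b, hab.symm, ha⟩
    refine ⟨transvection y x (u y - 1) * 1, ?_, y, ?_⟩
    · rw [Matrix.mul_one, det_transvection_of_ne _ _ hxy]
    · rw [transvection_mul_mulVec, if_pos rfl, Matrix.one_mulVec]
      have := hp x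
      have := hp y
      have : u x ≤ -1 := by omega
      nlinarith
  obtain ⟨U1, hc1, hpos1, hz1⟩ := exists_rowConn_single (U := U0) (v := u) (J := Set.univ) (o := a)
    trivial (by simpa using hp0)
  have hdet1 : U1.det = 1 := (rowConn_det hc1).trans hdet0
  have hinv : U1⁻¹ * U1 = 1 := Matrix.nonsing_inv_mul _ (by rw [hdet1]; exact isUnit_one)
  obtain ⟨z, hza, hz⟩ : ∃ z, z ≠ a ∧ (U1 *ᵥ w) z ≠ 0 := by
    by_contra! hcon
    have aux : ∀ t : ι → ℤ, (∀ x, x ≠ a → (U1 *ᵥ t) x = 0) →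
        ∀ x, t x = (U1 *ᵥ t) a * U1⁻¹ x a := by
      intro t ht x
      have h1 : U1 *ᵥ t = (U1 *ᵥ t) a • Pi.single a 1 := by
        ext x
        by_cases hx : x = a
        · subst hx; simp
        · simp [hx, ht x hx]
      have h2 : t = U1⁻¹ *ᵥ (U1 *ᵥ t) := by rw [Matrix.mulVec_mulVec, hinv, Matrix.one_mulVec]
      conv_lhs => rw [h2, h1, Matrix.mulVec_smul]
      simp
    apply h
    rw [aux u (fun x hx => hz1 x trivial hx) a, aux u (fun x hx => hz1 x trivial hx) b,
      aux w hcon a, aux w hcon b]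
    ring
  set K : ℤ := (1 + |(U1 *ᵥ w) a|) * (U1 *ᵥ w) z with hK
  set U2 := transvection a z K * U1 with hU2
  have hu2 : 0 < (U2 *ᵥ u) a := by
    rw [hU2, transvection_mul_mulVec, if_pos rfl, hz1 z trivial hza, mul_zero, add_zero]
    exact hpos1
  have hw2 : 0 < (U2 *ᵥ w) a := by
    rw [hU2, transvection_mul_mulVec, if_pos rfl, hK, mul_assoc]
    have h1 : 1 ≤ (U1 *ᵥ w) z * (U1 *ᵥ w) z := by
      have := mul_self_pos.2 hz
      omega
    have h2 := neg_abs_le ((U1 *ᵥ w) a)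
    have h3 := abs_nonneg ((U1 *ᵥ w) a)
    nlinarith
  let C : Matrix ι (Unit ⊕ Unit) ℤ := Matrix.fromCols (Matrix.replicateCol Unit u)
    (Matrix.replicateCol Unit w)
  have hCl : ∀ (X : Matrix ι ι ℤ) x, (X * C) x (Sum.inl ()) = (X *ᵥ u) x := fun _ _ => rfl
  have hCr : ∀ (X : Matrix ι ι ℤ) x, (X * C) x (Sum.inr ()) = (X *ᵥ w) x := fun _ _ => rfl
  obtain ⟨U3, hc3, h3⟩ := exists_rowConn_posSet (r := fun _ _ => True) (s := fun _ _ => True)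
    (C := C) (R := {a}) (U := U2)
    (fun x _ => ⟨a, rfl, trivial, fun _ _ => trivial⟩) (by
      rintro y rfl (z | z) _
      · exact hu2
      · exact hw2)
  refine ⟨U3, ?_, fun x => h3 x (Sum.inl ()) trivial, fun x => h3 x (Sum.inr ()) trivial⟩
  rw [rowConn_det hc3, hU2, Matrix.det_mul, det_transvection_of_ne _ _ hza.symm, hdet1, one_mul]

theorem colConn_of_rowConn_transpose {S S' : Set (Matrix ι ι ℤ)}
    (hS : ∀ X ∈ S, Xᵀ ∈ S') (h : RowConn (fun _ _ => True) S Uᵀ U'ᵀ) :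
    ColConn (fun _ _ => True) S' U U' := by
  have : ColConn (fun _ _ => True) S' Uᵀᵀ U'ᵀᵀ :=
    ReflTransGen.lift (r := RowStep (fun _ _ => True) S)
    (p := ColStep (fun _ _ => True) S') (fun Y => Yᵀ) (by
    rintro Y Z ⟨hY, hZ, x, y, hxy, _, c, hc, rfl⟩
    exact ⟨hS _ hY, hS _ hZ, y, x, hxy.symm, trivial, c, hc, by
      simp only [Matrix.transpose_mul, transpose_transvection]⟩) _ _ h
  rwa [Matrix.transpose_transpose, Matrix.transpose_transpose] at this

theorem colConn_univ_of_det_eq_one (hdet : U.det = 1) (hdet' : U'.det = 1) :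
    ColConn (fun _ _ => True) Set.univ U U' := by
  have aux : ∀ X : Matrix ι ι ℤ, X.det = 1 → RowConn (fun _ _ => True) Set.univ X 1 := fun X hX =>
    rowConn_mono (fun _ _ _ => trivial) le_rfl
      (rowConn_one_of_colTriv (D := ∅) hX (fun _ h => by simp at h))
  refine colConn_of_rowConn_transpose (S := Set.univ) (fun _ _ => trivial) ?_
  exact (aux _ (by rwa [Matrix.det_transpose])).trans
    (rowConn_symm (aux _ (by rwa [Matrix.det_transpose])))

theorem colConn_posVec (h3 : ∀ a b : ι, ∃ z, z ≠ a ∧ z ≠ b) (hdet : U.det = 1) (hdet' : U'.det = 1)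
    (hU : ∀ x, 0 < (v ᵥ* U) x) (hU' : ∀ x, 0 < (v ᵥ* U') x) :
    ColConn (fun _ _ => True) {X | ∀ x, 0 < (v ᵥ* X) x} U U' := by
  refine colConn_of_rowConn_transpose (S := posVec v) ?_ ?_
  · intro X hX x
    rw [Matrix.vecMul_transpose]; exact hX x
  · refine rowConn_posVec h3 (by rwa [Matrix.det_transpose]) (by rwa [Matrix.det_transpose]) ?_ ?_
    · intro x; rw [Matrix.mulVec_transpose]; exact hU x
    · intro x; rw [Matrix.mulVec_transpose]; exact hU' x

theorem exists_vecMul_pair {u w : ι → ℤ} {a b : ι} (h : u a * w b ≠ u b * w a) :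
    ∃ V : Matrix ι ι ℤ, V.det = 1 ∧ (∀ x, 0 < (u ᵥ* V) x) ∧ ∀ x, 0 < (w ᵥ* V) x := by
  obtain ⟨U, h1, h2, h3⟩ := exists_posVec_pair h
  exact ⟨Uᵀ, by rwa [Matrix.det_transpose], fun x => by rw [Matrix.vecMul_transpose]; exact h2 x,
    fun x => by rw [Matrix.vecMul_transpose]; exact h3 x⟩

end Vector

/-! ### Block matrices and block unipotent column operations -/

/-- A partial order on `Fin N` that is compatible with the natural order. -/
structure IsSubOrder {N : ℕ} (le : Fin N → Fin N → Prop) : Prop where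
  refl : ∀ i, le i i
  trans : ∀ i j k, le i j → le j k → le i k
  antisymm : ∀ i j, le i j → le j i → i = j
  imp : ∀ i j, le i j → i ≤ j

variable {N : ℕ} {le : Fin N → Fin N → Prop} {k m n : Fin N → ℕ}

theorem mem_MP_iff {B : Mat m n} : B ∈ MP le m n ↔ ∀ x y, B x y ≠ 0 → le x.1 y.1 := by
  constructor
  · rintro h ⟨i, a⟩ ⟨j, b⟩ hxy
    refine h i j fun h0 => hxy ?_
    exact congrFun (congrFun h0 a) b
  · intro h i j hij
    by_contra hle
    refine hij ?_
    ext a b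
    by_contra h0
    exact hle (h ⟨i, a⟩ ⟨j, b⟩ h0)

theorem mul_mem_MP (hle : IsSubOrder le) {A : Mat m n} {B : Mat n k} (hA : A ∈ MP le m n)
    (hB : B ∈ MP le n k) : A * B ∈ MP le m k := by
  rw [mem_MP_iff] at *
  intro x y hxy
  rw [Matrix.mul_apply] at hxy
  obtain ⟨z, -, hz⟩ := Finset.exists_ne_zero_of_sum_ne_zero hxy
  exact hle.trans _ _ _ (hA x z (left_ne_zero_of_mul hz)) (hB z y (right_ne_zero_of_mul hz))

theorem one_mem_MP (hle : IsSubOrder le) : (1 : Mat n n) ∈ MP le n n := by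
  rw [mem_MP_iff]
  intro x y hxy
  have : x = y := by
    by_contra h; exact hxy (Matrix.one_apply_ne h)
  rw [this]; exact hle.refl _

theorem transvection_mem_MP (hle : IsSubOrder le) {x y : Idx n} (hxy : le x.1 y.1) (c : ℤ) :
    transvection x y c ∈ MP le n n := by
  rw [mem_MP_iff]
  intro a b hab
  have h := transvection_mul_apply x y c (1 : Mat n n) a b
  rw [Matrix.mul_one] at h
  by_cases h1 : (1 : Mat n n) a b = 0
  · rw [h, h1, zero_add] at hab
    by_cases hax : a = x
    · rw [if_pos hax] at hab
      have : y = b := by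
        by_contra hne; exact hab (by rw [Matrix.one_apply_ne hne, mul_zero])
      rw [hax, ← this]; exact hxy
    · rw [if_neg hax] at hab; exact absurd rfl hab
  · exact mem_MP_iff.1 (one_mem_MP hle) a b h1

theorem block_mul (hle : IsSubOrder le) {A : Mat m n} {B : Mat n k} (hA : A ∈ MP le m n)
    (hB : B ∈ MP le n k) (i : Fin N) : block (A * B) i i = block A i i * block B i i := by
  ext a b
  rw [mem_MP_iff] at hA hB
  simp only [block, Matrix.of_apply, Matrix.mul_apply]
  rw [Fintype.sum_sigma, Finset.sum_eq_single i]
  · intro j _ hj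
    refine Finset.sum_eq_zero fun c _ => ?_
    by_contra h
    exact hj (hle.antisymm _ _ (hB _ _ (right_ne_zero_of_mul h)) (hA _ _ (left_ne_zero_of_mul h)))
  · simp

theorem block_one (i : Fin N) : block (1 : Mat n n) i i = 1 := by
  ext a b
  simp [block, Matrix.one_apply]

/-- The block unipotent matrices. -/
def unip (le : Fin N → Fin N → Prop) (n : Fin N → ℕ) : Set (Mat n n) :=
  {h | ∀ x y, h x y ≠ (1 : Mat n n) x y → le x.1 y.1 ∧ x.1 ≠ y.1}

theorem unip_subset_MP (hle : IsSubOrder le) : unip le n ⊆ MP le n n := by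
  intro h hh
  rw [mem_MP_iff]
  intro x y hxy
  by_cases h1 : h x y = (1 : Mat n n) x y
  · rw [h1] at hxy
    exact mem_MP_iff.1 (one_mem_MP hle) x y hxy
  · exact (hh x y h1).1

theorem mem_unip_iff (hle : IsSubOrder le) {h : Mat n n} :
    h ∈ unip le n ↔ h ∈ MP le n n ∧ ∀ i, block h i i = 1 := by
  constructor
  · intro hh
    refine ⟨unip_subset_MP hle hh, fun i => ?_⟩
    rw [← block_one]
    ext a b
    by_contra h1
    exact (hh ⟨i, a⟩ ⟨i, b⟩ h1).2 rfl
  · rintro ⟨h1, h2⟩ ⟨i, a⟩ ⟨j, b⟩ hxy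
    have hij : i ≠ j := by
      rintro rfl
      apply hxy
      have := congrFun (congrFun (h2 i) a) b
      rw [← block_one] at this
      exact this
    refine ⟨mem_MP_iff.1 h1 _ _ fun h0 => hxy ?_, hij⟩
    rw [h0, Matrix.one_apply_ne]
    rintro h
    exact hij (congrArg Sigma.fst h)

theorem one_mem_unip : (1 : Mat n n) ∈ unip le n := fun _ _ h => absurd rfl h

theorem mul_mem_unip (hle : IsSubOrder le) {g h : Mat n n} (hg : g ∈ unip le n)
    (hh : h ∈ unip le n) : g * h ∈ unip le n := by
  rw [mem_unip_iff hle] at *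
  refine ⟨mul_mem_MP hle hg.1 hh.1, fun i => ?_⟩
  rw [block_mul hle hg.1 hh.1, hg.2, hh.2, Matrix.one_mul]

/-- The matrix that adds `A c` times column `c` to column `y`. -/
def colAdd (A : Idx n → ℤ) (y : Idx n) : Mat n n :=
  1 + Matrix.of fun a b => if b = y then A a else 0

theorem colAdd_zero (y : Idx n) : colAdd (0 : Idx n → ℤ) y = 1 := by
  ext a b; simp [colAdd]

theorem mul_colAdd_apply {κ : Type*} (W : Matrix κ (Idx n) ℤ) (A : Idx n → ℤ) (y : Idx n)
    (a : κ) (z : Idx n) :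
    (W * colAdd A y) a z = W a z + if z = y then ∑ c, A c * W a c else 0 := by
  rw [colAdd, Matrix.mul_add, Matrix.mul_one, Matrix.add_apply, Matrix.mul_apply]
  congr 1
  split_ifs with h
  · simp [h, mul_comm]
  · simp [h]

theorem vecMul_eq_replicateRow_mul (v : Idx n → ℤ) (W : Mat n n) (z : Idx n) :
    (v ᵥ* W) z = (Matrix.replicateRow Unit v * W) () z := rfl

theorem vecMul_mul_colAdd (v : Idx n → ℤ) (W : Mat n n) (A : Idx n → ℤ) (y z : Idx n) :
    (v ᵥ* (W * colAdd A y)) z = (v ᵥ* W) z + if z = y then ∑ c, A c * (v ᵥ* W) c else 0 := by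
  rw [vecMul_eq_replicateRow_mul, ← Matrix.mul_assoc, mul_colAdd_apply]
  rfl

theorem vecMul_mul_transvection (v : Idx n → ℤ) (W : Mat n n) (x y : Idx n) (c : ℤ) (z : Idx n) :
    (v ᵥ* (W * transvection x y c)) z = (v ᵥ* W) z + if z = y then c * (v ᵥ* W) x else 0 := by
  rw [vecMul_eq_replicateRow_mul, ← Matrix.mul_assoc, mul_transvection_apply]
  rfl

/-- The columns which can be added to column `y` by a block unipotent matrix. -/
def belowSet (le : Fin N → Fin N → Prop) (y : Idx n) : Set (Idx n) :=
  {c | le c.1 y.1 ∧ c.1 ≠ y.1}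

theorem colAdd_mem_unip {A : Idx n → ℤ} {y : Idx n} (hA : ∀ c, c ∉ belowSet le y → A c = 0) :
    colAdd A y ∈ unip le n := by
  intro a b hab
  by_cases hb : b = y
  · subst hb
    by_contra hc
    exact hab (by simp [colAdd, hA a hc])
  · exact absurd (by simp [colAdd, hb]) hab

/-- The column operations between different blocks. -/
abbrev offDiag (le : Fin N → Fin N → Prop) (n : Fin N → ℕ) : Idx n → Idx n → Prop :=
  fun a b => le a.1 b.1 ∧ a.1 ≠ b.1

/-- The added columns lie in other blocks than `y` and stay fixed, so the coefficient vectors `A`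
form a lattice in which `hT` cuts out an upper set. -/
theorem colAdd_colConn {T : Set (Mat n n)} {W : Mat n n} {y : Idx n}
    (hT : ∀ A : Idx n → ℤ, (∀ c, c ∉ belowSet le y → A c = 0) → W * colAdd A y ∈ T →
      ∀ c ∈ belowSet le y, W * colAdd (A + Pi.single c 1 : Idx n → ℤ) y ∈ T)
    {A A' : Idx n → ℤ} (hA : ∀ c, c ∉ belowSet le y → A c = 0)
    (hA' : ∀ c, c ∉ belowSet le y → A' c = 0)
    (hAT : W * colAdd A y ∈ T) (hAT' : W * colAdd A' y ∈ T) :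
    ColConn (offDiag le n) T (W * colAdd A y) (W * colAdd A' y) := by
  have key := latticeStep_connected (J := belowSet le y)
    (S := {A | (∀ c, c ∉ belowSet le y → A c = 0) ∧ W * colAdd A y ∈ T})
    (fun A hA p hp => ⟨fun q hq => by
      rw [Pi.add_apply, hA.1 q hq, Pi.single_eq_of_ne (by rintro rfl; exact hq hp), add_zero],
      hT A hA.1 hA.2 p hp⟩) ⟨hA, hAT⟩ ⟨hA', hAT'⟩ (fun i hi => by rw [hA i hi, hA' i hi])
  refine ReflTransGen.lift (fun A : Idx n → ℤ => W * colAdd A y) ?_ _ _ key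
  rintro A A' ⟨hA, hA', x, hx, c, hc, rfl⟩
  have hne : x ≠ y := fun h => hx.2 (congrArg Sigma.fst h)
  refine ⟨hA.2, hA'.2, x, y, hne, hx, c, hc, ?_⟩
  ext a z
  change (W * colAdd _ y) a z = (W * colAdd A y * transvection x y c) a z
  rw [mul_colAdd_apply, mul_transvection_apply, mul_colAdd_apply, mul_colAdd_apply, if_neg hne]
  split_ifs with hz
  · simp only [Pi.add_apply, add_mul, Finset.sum_add_distrib, Pi.single_apply, ite_mul, zero_mul,
      Finset.sum_ite_eq', Finset.mem_univ, if_true]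
    ring
  · simp

/-! ### Families of vectors and positive column operations -/

section Positive

variable {Λ : Type*} {v : Λ → Idx n → ℤ} {blk : Λ → Fin N}

/-- The matrices `W` such that all `v l W` are positive where the block structure allows it. -/
def fullPos (le : Fin N → Fin N → Prop) (v : Λ → Idx n → ℤ) (blk : Λ → Fin N) : Set (Mat n n) :=
  {W | ∀ l y, le (blk l) y.1 → 0 < (v l ᵥ* W) y}

/-- The matrices `W` such that all `v l W` are positive in the block of `l`. -/
def diagPos (v : Λ → Idx n → ℤ) (blk : Λ → Fin N) : Set (Mat n n) :=
  {W | ∀ l y, blk l = y.1 → 0 < (v l ᵥ* W) y}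

/-- The matrices `W` such that all `v l W` vanish where the block structure says so. -/
def vecSupp (le : Fin N → Fin N → Prop) (v : Λ → Idx n → ℤ) (blk : Λ → Fin N) : Set (Mat n n) :=
  {W | ∀ l y, (v l ᵥ* W) y ≠ 0 → le (blk l) y.1}

theorem mul_mem_vecSupp (hle : IsSubOrder le) {W X : Mat n n} (hW : W ∈ vecSupp le v blk)
    (hX : X ∈ MP le n n) : W * X ∈ vecSupp le v blk := by
  intro l y hy
  rw [← Matrix.vecMul_vecMul] at hy
  obtain ⟨z, -, hz⟩ := Finset.exists_ne_zero_of_sum_ne_zero hy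
  exact hle.trans _ _ _ (hW l z (left_ne_zero_of_mul hz))
    (mem_MP_iff.1 hX z y (right_ne_zero_of_mul hz))

/-- The vector `v l W` vanishes in blocks strictly below `blk l`, and only columns from such blocks
could be added to a column of block `blk l`. -/
theorem vecMul_mul_unip (hle : IsSubOrder le) {W h : Mat n n} (hW : W ∈ vecSupp le v blk)
    (hh : h ∈ unip le n) {l : Λ} {y : Idx n} (hy : blk l = y.1) :
    (v l ᵥ* (W * h)) y = (v l ᵥ* W) y := by
  rw [← Matrix.vecMul_vecMul]
  have : ((v l ᵥ* W) ᵥ* h) y = ((v l ᵥ* W) ᵥ* (1 : Mat n n)) y := by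
    refine Finset.sum_congr rfl fun z _ => ?_
    by_cases hz : (v l ᵥ* W) z = 0
    · rw [hz, zero_mul, zero_mul]
    · congr 1
      by_contra h1
      have h2 := hh z y h1
      refine h2.2 (hle.antisymm _ _ h2.1 ?_)
      rw [← hy]; exact hW l z hz
  rw [this, Matrix.vecMul_one]

theorem vecMul_nonneg {W : Mat n n} (hW : W ∈ vecSupp le v blk) {l : Λ} {c : Idx n}
    (hpos : le (blk l) c.1 → 0 < (v l ᵥ* W) c) : 0 ≤ (v l ᵥ* W) c := by
  by_cases h : (v l ᵥ* W) c = 0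
  · exact h.ge
  · exact (hpos (hW l c h)).le

theorem colAdd_fullPos_up {W : Mat n n} (hW : W ∈ vecSupp le v blk) (hW' : W ∈ fullPos le v blk)
    (y : Idx n) (A : Idx n → ℤ) (hA : W * colAdd A y ∈ fullPos le v blk) (c : Idx n) :
    W * colAdd (A + Pi.single c 1 : Idx n → ℤ) y ∈ fullPos le v blk := by
  intro l z hz
  have h1 := hA l z hz
  rw [vecMul_mul_colAdd] at h1 ⊢
  split_ifs at h1 ⊢ with hzy
  · have h2 : ∑ b, (A + Pi.single c 1 : Idx n → ℤ) b * (v l ᵥ* W) b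
        = ∑ b, A b * (v l ᵥ* W) b + (v l ᵥ* W) c := by
      simp [add_mul, Finset.sum_add_distrib, Pi.single_apply]
    rw [h2]
    have := vecMul_nonneg hW (hW' l c)
    linarith
  · exact h1

/-- A block unipotent matrix is a product of elementary ones, with positivity at every stage. -/
theorem colConn_fullPos_unip (hle : IsSubOrder le) {W h : Mat n n} (hW : W ∈ vecSupp le v blk)
    (hpos : W ∈ fullPos le v blk) (hh : h ∈ unip le n) (hpos' : W * h ∈ fullPos le v blk) :
    ColConn (offDiag le n) (fullPos le v blk) W (W * h) := by
  classical
  induction hk : (Finset.univ.filter fun y => ∃ x, h x y ≠ (1 : Mat n n) x y).card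
    using Nat.strong_induction_on generalizing h with
  | _ k ih =>
    by_cases hne : (Finset.univ.filter fun y => ∃ x, h x y ≠ (1 : Mat n n) x y).Nonempty
    swap
    · have : h = 1 := by
        ext x y
        by_contra hxy
        exact hne ⟨y, Finset.mem_filter.2 ⟨Finset.mem_univ _, x, hxy⟩⟩
      rw [this, Matrix.mul_one]
    -- Minimality of the block of `y` makes the columns of `h` in lower blocks trivial. Hence column
    -- `y` can be split off as the last factor.
    obtain ⟨y, hy, hmin⟩ := Finset.exists_min_image _ (fun y : Idx n => y.1) hne
    let h' : Mat n n := Matrix.of fun a b => if b = y then (1 : Mat n n) a b else h a b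
    let A : Idx n → ℤ := fun a => h a y - (1 : Mat n n) a y
    have hh'y : ∀ a b, b = y → h' a b = (1 : Mat n n) a b := fun a b hb => if_pos hb
    have hA : ∀ c, c ∉ belowSet le y → A c = 0 := by
      intro c hc
      by_contra h0
      exact hc (hh c y fun h1 => h0 (by simp [A, h1]))
    have hh' : h' ∈ unip le n := by
      intro a b hab
      by_cases hb : b = y
      · exact absurd (hh'y a b hb) hab
      · exact hh a b (by simpa [h', hb] using hab)
    have hmul : h = h' * colAdd A y := by
      ext a b
      rw [mul_colAdd_apply]
      by_cases hb : b = y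
      · have h1 : ∑ c, A c * h' a c = A a := by
          rw [Finset.sum_eq_single a]
          · by_cases hay : a = y
            · simp [h', hay]
            · by_cases h0 : A a = 0
              · simp [h0]
              · have hbel : a ∈ belowSet le y := by
                  by_contra hc; exact h0 (hA a hc)
                have : h a a = (1 : Mat n n) a a := by
                  by_contra hne; exact (hh a a hne).2 rfl
                simp [h', hay, this]
          · intro c _ hca
            by_cases h0 : A c = 0
            · simp [h0]
            have hbel : c ∈ belowSet le y := by
              by_contra hc; exact h0 (hA c hc)
            have hcy : c ≠ y := fun h => hbel.2 (congrArg Sigma.fst h)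
            have : h a c = (1 : Mat n n) a c := by
              by_contra hne
              have := hmin c (Finset.mem_filter.2 ⟨Finset.mem_univ _, a, hne⟩)
              exact hbel.2 (le_antisymm (hle.imp _ _ hbel.1) this)
            simp [h', hcy, this, Matrix.one_apply_ne hca.symm]
          · simp
        rw [if_pos hb, h1, hb]
        simp [h', A]
      · simp [h', hb]
    -- Every column of `W * h'` is a column of `W` or of `W * h`.
    have hpos1 : W * h' ∈ fullPos le v blk := by
      intro l z hz
      by_cases hzy : z = y
      · have : (v l ᵥ* (W * h')) z = (v l ᵥ* W) z := by
          rw [← Matrix.vecMul_vecMul]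
          have h2 : ((v l ᵥ* W) ᵥ* h') z = ((v l ᵥ* W) ᵥ* (1 : Mat n n)) z := by
            exact Finset.sum_congr rfl fun a _ => congrArg _ (hh'y a z hzy)
          rw [h2, Matrix.vecMul_one]
        rw [this]; exact hpos l z hz
      · have : (v l ᵥ* (W * h')) z = (v l ᵥ* (W * h)) z := by
          rw [← Matrix.vecMul_vecMul, ← Matrix.vecMul_vecMul]
          refine Finset.sum_congr rfl fun a _ => ?_
          simp [h', hzy]
        rw [this]; exact hpos' l z hz
    have hc1 := ih _ (by
      rw [← hk]
      refine Finset.card_lt_card (Finset.ssubset_iff_of_subset ?_ |>.2 ⟨y, hy, ?_⟩)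
      · intro z hz
        simp only [Finset.mem_filter, Finset.mem_univ, true_and] at hz ⊢
        obtain ⟨x, hx⟩ := hz
        refine ⟨x, ?_⟩
        by_cases hzy : z = y
        · exact absurd (hh'y x z hzy) hx
        · simpa [h', hzy] using hx
      · simp [h']) hh' hpos1 rfl
    have hW1 := mul_mem_vecSupp hle hW (unip_subset_MP hle hh')
    have hc2 := colAdd_colConn (le := le) (T := fullPos le v blk) (W := W * h') (y := y)
      (fun B _ hB c _ => colAdd_fullPos_up hW1 hpos1 y B hB c) (A := 0) (A' := A)
      (fun _ _ => rfl) hA (by rwa [colAdd_zero, Matrix.mul_one])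
      (by rwa [Matrix.mul_assoc, ← hmul])
    rw [colAdd_zero, Matrix.mul_one, Matrix.mul_assoc, ← hmul] at hc2
    exact hc1.trans hc2

theorem colConn_univ_unip (hle : IsSubOrder le) {h : Mat n n} (W : Mat n n) (hh : h ∈ unip le n) :
    ColConn (offDiag le n) Set.univ W (W * h) :=
  colConn_mono (fun _ _ h => h) (Set.subset_univ _)
    (colConn_fullPos_unip (Λ := Empty) (v := fun l => l.elim) (blk := fun l => l.elim) hle
      (fun l => l.elim) (fun l => l.elim) hh (fun l => l.elim))

/-- A path of operations from `1` to `h`, read backwards, multiplies `h` by unipotent factors until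
it becomes `1`. -/
theorem exists_inv_unip (hle : IsSubOrder le) {h : Mat n n} (hh : h ∈ unip le n) :
    ∃ g ∈ unip le n, h * g = 1 := by
  have aux : ∀ Y, ColConn (offDiag le n) Set.univ h Y → ∃ g ∈ unip le n, h * g = Y := by
    intro Y hY
    induction hY with
    | refl => exact ⟨1, one_mem_unip, Matrix.mul_one _⟩
    | tail _ hs ih =>
      obtain ⟨-, -, x, y, hxy, hr, c, -, rfl⟩ := hs
      obtain ⟨g, hg, rfl⟩ := ih
      refine ⟨g * transvection x y c, mul_mem_unip hle hg ?_, (Matrix.mul_assoc _ _ _).symm⟩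
      intro a b hab
      by_contra hcon
      apply hab
      have := mul_transvection_apply x y c (1 : Mat n n) a b
      rw [Matrix.one_mul] at this
      rw [this]
      by_cases hb : b = y
      · rw [if_pos hb]
        by_cases hax : a = x
        · subst hax hb; exact absurd hr hcon
        · rw [Matrix.one_apply_ne hax]; simp
      · simp [hb]
  refine aux 1 (colConn_symm ?_)
  have := colConn_univ_unip hle 1 hh
  rwa [Matrix.one_mul] at this

/-- Columns of lower blocks can be added to a column to make it large. -/
theorem exists_colAdd (hle : IsSubOrder le) [Finite Λ] (hn : ∀ l, n (blk l) ≠ 0) {W : Mat n n}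
    (hW : W ∈ vecSupp le v blk) {y : Idx n}
    (hpos : ∀ l, ∀ c ∈ belowSet le y, le (blk l) c.1 → 0 < (v l ᵥ* W) c) (K : ℤ) :
    ∃ A : Idx n → ℤ, (∀ c, c ∉ belowSet le y → A c = 0) ∧
      (∀ l, (v l ᵥ* W) y ≤ (v l ᵥ* (W * colAdd A y)) y) ∧
      ∀ l, le (blk l) y.1 → blk l ≠ y.1 → K < (v l ᵥ* (W * colAdd A y)) y := by
  classical
  obtain ⟨M, hM0, hM⟩ := exists_int_bound fun l => (v l ᵥ* W) y
  have hnn : ∀ l, ∀ c ∈ belowSet le y, 0 ≤ (v l ᵥ* W) c := fun l c hc =>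
    vecMul_nonneg hW (hpos l c hc)
  let A : Idx n → ℤ := fun c => if c ∈ belowSet le y then M + |K| + 1 else 0
  have hterm : ∀ l c, 0 ≤ A c * (v l ᵥ* W) c := by
    intro l c
    by_cases hc : c ∈ belowSet le y
    · have := hnn l c hc
      have := abs_nonneg K
      simp only [A, hc, if_true]; positivity
    · simp [A, hc]
  refine ⟨A, fun c hc => if_neg hc, fun l => ?_, fun l hl hne => ?_⟩
  · rw [vecMul_mul_colAdd, if_pos rfl]
    have := Finset.sum_nonneg (s := Finset.univ) fun c _ => hterm l c
    linarith
  · rw [vecMul_mul_colAdd, if_pos rfl]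
    -- A column in the vector's own block, where its entry is at least 1; it alone contributes `M +
    -- |K| + 1`.
    let c0 : Idx n := ⟨blk l, ⟨0, Nat.pos_of_ne_zero (hn l)⟩⟩
    have hc0 : c0 ∈ belowSet le y := ⟨hl, hne⟩
    have h1 := Finset.single_le_sum (s := Finset.univ) (fun c _ => hterm l c) (Finset.mem_univ c0)
    have h2 := hM l
    have h3 := abs_le.1 h2
    have h4 : A c0 = M + |K| + 1 := if_pos hc0
    have h5 : 1 ≤ (v l ᵥ* W) c0 := hpos l c0 hc0 (hle.refl _)
    have h6 := le_abs_self K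
    have h7 := abs_nonneg K
    rw [h4] at h1
    nlinarith

/-- Columns are treated in the order of their blocks. Entries in a vector's own block are positive
and cannot change; in higher blocks they become positive by adding columns already treated. -/
theorem exists_unip_fullPos (hle : IsSubOrder le) [Finite Λ] (hn : ∀ l, n (blk l) ≠ 0) {W : Mat n n}
    (hW : W ∈ vecSupp le v blk) (hdiag : W ∈ diagPos v blk) :
    ∃ h ∈ unip le n, W * h ∈ fullPos le v blk := by
  classical
  have key : ∀ k, ∀ D : Finset (Idx n), Dᶜ.card = k →
      (∀ d ∈ D, ∀ c ∈ belowSet le d, c ∈ D) → ∀ h ∈ unip le n,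
      (∀ l, ∀ y ∈ D, le (blk l) y.1 → 0 < (v l ᵥ* (W * h)) y) →
      ∃ h ∈ unip le n, W * h ∈ fullPos le v blk := by
    intro k
    induction k with
    | zero =>
      intro D hD _ h hh hpos
      refine ⟨h, hh, fun l y hy => hpos l y ?_ hy⟩
      rw [Finset.card_eq_zero, Finset.compl_eq_empty_iff] at hD
      rw [hD]; exact Finset.mem_univ _
    | succ k ih =>
      intro D hD hdown h hh hpos
      obtain ⟨y, hy, hmin⟩ := Finset.exists_min_image Dᶜ (fun y : Idx n => y.1)
        (Finset.card_pos.1 (by omega))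
      rw [Finset.mem_compl] at hy
      have hbel : ∀ c ∈ belowSet le y, c ∈ D := by
        intro c hc
        by_contra hcD
        exact hc.2 (le_antisymm (hle.imp _ _ hc.1) (hmin c (Finset.mem_compl.2 hcD)))
      have hWh := mul_mem_vecSupp hle hW (unip_subset_MP hle hh)
      obtain ⟨A, hA, -, hA2⟩ := exists_colAdd hle hn hWh (y := y)
        (fun l c hc => hpos l c (hbel c hc)) 0
      refine ih (insert y D) ?_ ?_ (h * colAdd A y) (mul_mem_unip hle hh (colAdd_mem_unip hA)) ?_
      · rw [Finset.compl_insert, Finset.card_erase_of_mem (Finset.mem_compl.2 hy)]; omega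
      · intro d hd c hc
        rcases Finset.mem_insert.1 hd with rfl | hd
        · exact Finset.mem_insert_of_mem (hbel c hc)
        · exact Finset.mem_insert_of_mem (hdown d hd c hc)
      · intro l z hz hlz
        rw [← Matrix.mul_assoc]
        rcases Finset.mem_insert.1 hz with rfl | hz'
        · by_cases hb : blk l = z.1
          · rw [vecMul_mul_unip hle hWh (colAdd_mem_unip hA) hb, vecMul_mul_unip hle hW hh hb]
            exact hdiag l z hb
          · exact hA2 l hlz hb
        · rw [vecMul_mul_colAdd, if_neg (by rintro rfl; exact hy hz'), add_zero]
          exact hpos l z hz' hlz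
  exact key _ ∅ rfl (by simp) 1 one_mem_unip (by simp)

/-- Conjugation by an elementary matrix inside a diagonal block. -/
theorem conj_mem_unip {h : Mat n n} (hh : h ∈ unip le n) {x y : Idx n} (hxy : x ≠ y)
    (hb : x.1 = y.1) (c : ℤ) :
    transvection x y (-c) * h * transvection x y c ∈ unip le n := by
  have h1 : ∀ a b : Idx n, ¬ (le a.1 b.1 ∧ a.1 ≠ b.1) → h a b = (1 : Mat n n) a b := by
    intro a b hab
    by_contra hne
    exact hab (hh a b hne)
  intro a b hab
  by_contra hcon
  apply hab
  rw [mul_transvection_apply, transvection_mul_apply, transvection_mul_apply]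
  have hyx : h y x = 0 := by
    rw [h1 y x (fun h => h.2 hb.symm), Matrix.one_apply_ne hxy.symm]
  rw [h1 a b hcon, hyx]
  by_cases hax : a = x <;> by_cases hby : b = y
  · subst hax hby
    rw [h1 a a (fun h => h.2 rfl), h1 b b (fun h => h.2 rfl)]
    simp
  · subst hax
    rw [h1 y b (fun h => hcon ⟨by rw [hb]; exact h.1, by rw [hb]; exact h.2⟩),
      Matrix.one_apply_ne (Ne.symm hby)]
    simp [hby]
  · subst hby
    rw [h1 a x (fun h => hcon ⟨by rw [← hb]; exact h.1, by rw [← hb]; exact h.2⟩),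
      Matrix.one_apply_ne hax]
    simp [hax]
  · simp [hax, hby]

theorem vecMul_blockDiagonal' (u : Idx n → ℤ) (δ : ∀ i, Matrix (Fin (n i)) (Fin (n i)) ℤ)
    (i : Fin N) (a : Fin (n i)) :
    (u ᵥ* (Matrix.blockDiagonal' δ)) ⟨i, a⟩ = ((fun b => u ⟨i, b⟩) ᵥ* δ i) a := by
  simp only [Matrix.vecMul, dotProduct]
  rw [Fintype.sum_sigma, Finset.sum_eq_single i]
  · simp [Matrix.blockDiagonal'_apply_eq]
  · intro j _ hj
    refine Finset.sum_eq_zero fun c _ => ?_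
    rw [Matrix.blockDiagonal'_apply_ne _ _ _ hj, mul_zero]
  · simp

theorem blockDiagonal'_mem_MP (hle : IsSubOrder le)
    (δ : ∀ i, Matrix (Fin (n i)) (Fin (n i)) ℤ) :
    (Matrix.blockDiagonal' δ : Mat n n) ∈ MP le n n := by
  rw [mem_MP_iff]
  rintro ⟨i, a⟩ ⟨j, b⟩ h
  by_cases hij : i = j
  · subst hij; exact hle.refl _
  · exact absurd (Matrix.blockDiagonal'_apply_ne _ _ _ hij) h

theorem block_blockDiagonal' (δ : ∀ i, Matrix (Fin (n i)) (Fin (n i)) ℤ) (i : Fin N) :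
    block (Matrix.blockDiagonal' δ : Mat n n) i i = δ i := by
  ext a b
  exact Matrix.blockDiagonal'_apply_eq δ i a b

theorem blockDiagonal'_update (δ : ∀ i, Matrix (Fin (n i)) (Fin (n i)) ℤ) (i : Fin N)
    (Y : Matrix (Fin (n i)) (Fin (n i)) ℤ) (a b : Fin (n i)) (c : ℤ) :
    (Matrix.blockDiagonal' (Function.update δ i (Y * transvection a b c)) : Mat n n)
      = Matrix.blockDiagonal' (Function.update δ i Y) *
        transvection (⟨i, a⟩ : Idx n) ⟨i, b⟩ c := by
  ext ⟨p, s⟩ ⟨q, t⟩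
  rw [mul_transvection_apply]
  by_cases hpq : p = q
  · subst hpq
    rw [Matrix.blockDiagonal'_apply_eq, Matrix.blockDiagonal'_apply_eq]
    by_cases hpi : p = i
    · subst hpi
      rw [Function.update_self, Function.update_self, mul_transvection_apply,
        Matrix.blockDiagonal'_apply_eq, Function.update_self]
      simp
    · rw [Function.update_of_ne hpi, Function.update_of_ne hpi]
      simp [hpi]
  · rw [Matrix.blockDiagonal'_apply_ne _ _ _ hpq, Matrix.blockDiagonal'_apply_ne _ _ _ hpq]
    split_ifs with h
    · have hqi : q = i := congrArg Sigma.fst h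
      rw [Matrix.blockDiagonal'_apply_ne _ _ _ (hqi ▸ hpq)]
      simp
    · simp

/-- One elementary column operation inside a diagonal block. -/
def DiagStep (le : Fin N → Fin N → Prop) (v : Λ → Idx n → ℤ) (blk : Λ → Fin N)
    (W W' : Mat n n) : Prop :=
  W ∈ vecSupp le v blk ∧ W' ∈ vecSupp le v blk ∧ ColStep (fun x y => x.1 = y.1) (diagPos v blk) W W'

/-- One block is changed at a time. Injectivity of `blk` leaves at most one vector to keep positive
there, which is the case of `colConn_posVec`; a block without a vector carries no condition. -/
theorem diagStep_blockDiagonal' (hle : IsSubOrder le) (hblk : Function.Injective blk)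
    (hn : ∀ l, 3 ≤ n (blk l)) {W : Mat n n} (hW : W ∈ vecSupp le v blk)
    {δ δ' : ∀ i, Matrix (Fin (n i)) (Fin (n i)) ℤ} (hδ : ∀ i, (δ i).det = 1)
    (hδ' : ∀ i, (δ' i).det = 1) (hpos : W * Matrix.blockDiagonal' δ ∈ diagPos v blk)
    (hpos' : W * Matrix.blockDiagonal' δ' ∈ diagPos v blk) :
    ReflTransGen (DiagStep le v blk) (W * Matrix.blockDiagonal' δ)
      (W * Matrix.blockDiagonal' δ') := by
  have hval : ∀ (η : ∀ i, Matrix (Fin (n i)) (Fin (n i)) ℤ),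
      W * Matrix.blockDiagonal' η ∈ diagPos v blk ↔
      ∀ l a, 0 < ((fun b => (v l ᵥ* W) ⟨blk l, b⟩) ᵥ* η (blk l)) a := by
    intro η
    constructor
    · intro h l a
      have := h l ⟨blk l, a⟩ rfl
      rwa [← Matrix.vecMul_vecMul, vecMul_blockDiagonal'] at this
    · rintro h l ⟨i, a⟩ hi
      simp only at hi
      subst hi
      rw [← Matrix.vecMul_vecMul, vecMul_blockDiagonal']
      exact h l a
  have hone : ∀ (η : ∀ i, Matrix (Fin (n i)) (Fin (n i)) ℤ) (i : Fin N)
      (Y : Matrix (Fin (n i)) (Fin (n i)) ℤ), (η i).det = 1 → Y.det = 1 →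
      W * Matrix.blockDiagonal' η ∈ diagPos v blk →
      W * Matrix.blockDiagonal' (Function.update η i Y) ∈ diagPos v blk →
      ReflTransGen (DiagStep le v blk) (W * Matrix.blockDiagonal' η)
        (W * Matrix.blockDiagonal' (Function.update η i Y)) := by
    intro η i Y hη hY h1 h2
    rw [hval] at h1 h2
    have hconn : ColConn (fun _ _ => True) {Z : Matrix (Fin (n i)) (Fin (n i)) ℤ |
        W * Matrix.blockDiagonal' (Function.update η i Z) ∈ diagPos v blk} (η i) Y := by
      by_cases hl : ∃ l, blk l = i
      · obtain ⟨l, rfl⟩ := hl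
        refine colConn_mono (fun _ _ h => h) ?_ (colConn_posVec
          (v := fun b => (v l ᵥ* W) ⟨blk l, b⟩) ?_ hη hY (h1 l) ?_)
        · intro Z hZ
          simp only [Set.mem_ofPred_eq] at hZ ⊢
          rw [hval]
          intro l' a
          by_cases hll : l' = l
          · subst hll; rw [Function.update_self]; exact hZ a
          · rw [Function.update_of_ne (fun h => hll (hblk h))]; exact h1 l' a
        · intro a b
          have h3 : ({a, b} : Finset (Fin (n (blk l)))).card < Fintype.card (Fin (n (blk l))) := by
            have := Finset.card_le_two (a := a) (b := b)
            have := hn l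
            rw [Fintype.card_fin]; omega
          obtain ⟨z, hz⟩ := Finset.exists_mem_notMem_of_card_lt_card
            (s := {a, b}) (t := Finset.univ) (by rwa [Finset.card_univ])
          simp only [Finset.mem_insert, Finset.mem_singleton, not_or] at hz
          exact ⟨z, hz.2⟩
        · have := h2 l
          rwa [Function.update_self] at this
      · refine colConn_mono (fun _ _ h => h) ?_ (colConn_univ_of_det_eq_one hη hY)
        intro Z _
        simp only [Set.mem_ofPred_eq]
        rw [hval]
        intro l a
        rw [Function.update_of_ne (fun h => hl ⟨l, h⟩)]; exact h1 l a
    have hlift : ReflTransGen (DiagStep le v blk)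
        (W * Matrix.blockDiagonal' (Function.update η i (η i)))
        (W * Matrix.blockDiagonal' (Function.update η i Y)) := by
      refine ReflTransGen.lift (fun Z => W * Matrix.blockDiagonal' (Function.update η i Z)) ?_
        _ _ hconn
      rintro Z Z' ⟨hZ, hZ', a, b, hab, -, c, hc, rfl⟩
      refine ⟨mul_mem_vecSupp hle hW (blockDiagonal'_mem_MP hle _),
        mul_mem_vecSupp hle hW (blockDiagonal'_mem_MP hle _), hZ, hZ', ⟨i, a⟩, ⟨i, b⟩, ?_, rfl,
        c, hc, ?_⟩
      · intro h
        exact hab (by simpa using h)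
      · simp only [blockDiagonal'_update, Matrix.mul_assoc]
    rwa [Function.update_eq_self] at hlift
  have hfin : ∀ (s : Finset (Fin N)) (η : ∀ i, Matrix (Fin (n i)) (Fin (n i)) ℤ),
      (∀ i, (η i).det = 1) → W * Matrix.blockDiagonal' η ∈ diagPos v blk →
      (∀ i, i ∉ s → η i = δ' i) →
      ReflTransGen (DiagStep le v blk) (W * Matrix.blockDiagonal' η)
        (W * Matrix.blockDiagonal' δ') := by
    intro s
    induction s using Finset.induction_on with
    | empty =>
      intro η _ _ h
      rw [show η = δ' from funext fun i => h i (by simp)]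
    | insert i s hi ih =>
      intro η hη hη' h
      have hp : W * Matrix.blockDiagonal' (Function.update η i (δ' i)) ∈ diagPos v blk := by
        rw [hval] at hη' hpos' ⊢
        intro l a
        by_cases hli : blk l = i
        · subst hli; rw [Function.update_self]; exact hpos' l a
        · rw [Function.update_of_ne hli]; exact hη' l a
      refine (hone η i (δ' i) (hη i) (hδ' i) hη' hp).trans (ih _ ?_ hp ?_)
      · intro j
        by_cases hj : j = i
        · subst hj; rw [Function.update_self]; exact hδ' j
        · rw [Function.update_of_ne hj]; exact hη j
      · intro j hj
        by_cases hji : j = i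
        · subst hji; rw [Function.update_self]
        · rw [Function.update_of_ne hji]; exact h j (by simp [hji, hj])
  exact hfin Finset.univ δ hδ hpos (fun i hi => absurd (Finset.mem_univ i) hi)

/-- Taking diagonal blocks is multiplicative, so the diagonal blocks of the inverse of `X` invert
those of `X`. -/
theorem exists_blockDiagonal'_mul_unip (hle : IsSubOrder le) {X : Mat n n} (hX : X ∈ SLP le n) :
    ∃ h ∈ unip le n, X = Matrix.blockDiagonal' (fun i => block X i i) * h := by
  obtain ⟨⟨hX1, Y, hY, hXY, hYX⟩, -⟩ := hX
  have hb : ∀ i, block X i i * block Y i i = 1 := fun i => by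
    rw [← block_mul hle hX1 hY, hXY, block_one]
  have hb' : ∀ i, block Y i i * block X i i = 1 := fun i => by
    rw [← block_mul hle hY hX1, hYX, block_one]
  refine ⟨Matrix.blockDiagonal' (fun i => block Y i i) * X, ?_, ?_⟩
  · rw [mem_unip_iff hle]
    refine ⟨mul_mem_MP hle (blockDiagonal'_mem_MP hle _) hX1, fun i => ?_⟩
    rw [block_mul hle (blockDiagonal'_mem_MP hle _) hX1, block_blockDiagonal', hb']
  · rw [← Matrix.mul_assoc, ← Matrix.blockDiagonal'_mul]
    simp only [hb]
    have : (fun i => (1 : Matrix (Fin (n i)) (Fin (n i)) ℤ)) = (1 : ∀ i, Matrix (Fin (n i)) (Fin (n i)) ℤ) :=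
      rfl
    rw [this, Matrix.blockDiagonal'_one, Matrix.one_mul]

theorem det_block_of_mem_SLP {X : Mat n n} (hX : X ∈ SLP le n) (i : Fin N) :
    (block X i i).det = 1 := by
  by_cases hi : n i = 0
  · have : IsEmpty (Fin (n i)) := by rw [hi]; infer_instance
    exact Matrix.det_isEmpty
  · exact hX.2 i hi

/-- The elements `X` of `SL_𝒫` such that all `v l W X` are positive are connected, if there is at
most one `l` for each block. -/
theorem colConn_fullPos (hle : IsSubOrder le) [Finite Λ] (hblk : Function.Injective blk)
    (hn : ∀ l, 3 ≤ n (blk l)) {W X : Mat n n} (hW : W ∈ vecSupp le v blk)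
    (hpos : W ∈ fullPos le v blk) (hX : X ∈ SLP le n) (hpos' : W * X ∈ fullPos le v blk) :
    ColConn (fun x y => le x.1 y.1) (fullPos le v blk) W (W * X) := by
  have hn0 : ∀ l, n (blk l) ≠ 0 := fun l => by have := hn l; omega
  obtain ⟨h, hh, hXh⟩ := exists_blockDiagonal'_mul_unip hle hX
  set δ : ∀ i, Matrix (Fin (n i)) (Fin (n i)) ℤ := fun i => block X i i with hδ
  have hWδ : W * Matrix.blockDiagonal' δ ∈ vecSupp le v blk :=
    mul_mem_vecSupp hle hW (blockDiagonal'_mem_MP hle _)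
  have hWX : W * X = W * Matrix.blockDiagonal' δ * h := by
    rw [Matrix.mul_assoc, ← hXh]
  have hpath : ReflTransGen (DiagStep le v blk) W (W * Matrix.blockDiagonal' δ) := by
    have h1 : W * Matrix.blockDiagonal' (1 : ∀ i, Matrix (Fin (n i)) (Fin (n i)) ℤ) = W := by
      rw [Matrix.blockDiagonal'_one, Matrix.mul_one]
    have := diagStep_blockDiagonal' hle hblk hn hW (δ := 1) (δ' := δ) (fun i => Matrix.det_one)
      (det_block_of_mem_SLP hX) (by
        rw [h1]; exact fun l y hy => hpos l y (hy ▸ hle.refl _)) (by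
        intro l y hy
        rw [← vecMul_mul_unip hle hWδ hh hy, ← hWX]
        exact hpos' l y (hy ▸ hle.refl _))
    rwa [h1] at this
  -- The path controls positivity in the own blocks only; over each of its points lie the fully
  -- positive unipotent multiples.
  let F : Mat n n → Set (Mat n n) := fun Y =>
    {p | Y ∈ vecSupp le v blk ∧ p ∈ fullPos le v blk ∧ ∃ h ∈ unip le n, p = Y * h}
  have hmono : ∀ {p q : Mat n n}, ColConn (offDiag le n) (fullPos le v blk) p q →
      ColConn (fun x y => le x.1 y.1) (fullPos le v blk) p q := fun h =>
    colConn_mono (fun _ _ h => h.1) le_rfl h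
  have hrefl : ∀ Y, ∀ p ∈ F Y, ∀ p' ∈ F Y,
      ColConn (fun x y => le x.1 y.1) (fullPos le v blk) p p' := by
    rintro Y p ⟨hY, hp, h, hh, rfl⟩ p' ⟨-, hp', h', hh', rfl⟩
    obtain ⟨g, hg, hhg⟩ := exists_inv_unip hle hh
    have hEq : Y * h' = Y * h * (g * h') := by
      rw [Matrix.mul_assoc, ← Matrix.mul_assoc h, hhg, Matrix.one_mul]
    rw [hEq] at hp' ⊢
    exact hmono (colConn_fullPos_unip hle (mul_mem_vecSupp hle hY (unip_subset_MP hle hh)) hp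
      (mul_mem_unip hle hg hh') hp')
  refine conn_of_fibres (conn := ColConn (fun x y => le x.1 y.1) (fullPos le v blk))
    (fun _ _ _ h h' => h.trans h') (F := F) (E := DiagStep le v blk) ?_ ?_ (hrefl W) hpath
    W ⟨hW, hpos, 1, one_mem_unip, (Matrix.mul_one _).symm⟩
    (W * X) ⟨hWδ, hpos', h, hh, hWX⟩
  · intro Y Y' hs
    obtain ⟨h, hh, hp⟩ := exists_unip_fullPos hle hn0 hs.2.1 hs.2.2.2.1
    exact ⟨_, hs.2.1, hp, h, hh, rfl⟩
  · rintro Y _ ⟨hY, hY', hYd, hYd', x, y, hxy, hb, c, hc, rfl⟩ p hp p' hp'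
    obtain ⟨h, hh, hYh⟩ := exists_unip_fullPos hle hn0 hY hYd
    have hYhs := mul_mem_vecSupp hle hY (unip_subset_MP hle hh)
    -- Outside the own block of `l`, column `y` is raised above the size of column `x`, so the
    -- transvection keeps it positive. In the own block positivity is given by the path.
    obtain ⟨K, hK0, hK⟩ := exists_int_bound fun l => (v l ᵥ* (Y * h)) x
    obtain ⟨A, hA, hA1, hA2⟩ := exists_colAdd hle hn0 hYhs (y := y) (fun l c _ => hYh l c) K
    have hAu := colAdd_mem_unip hA
    have hq : Y * h * colAdd A y ∈ fullPos le v blk := by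
      intro l z hz
      have h1 := hYh l z hz
      by_cases hzy : z = y
      · subst hzy; exact h1.trans_le (hA1 l)
      · rw [vecMul_mul_colAdd, if_neg hzy, add_zero]; exact h1
    have hq' : Y * h * colAdd A y * transvection x y c ∈ fullPos le v blk := by
      intro l z hz
      have h1 := hq l z hz
      by_cases hzy : z = y
      · subst hzy
        by_cases hl : blk l = z.1
        · rw [vecMul_mul_transvection, if_pos rfl, vecMul_mul_unip hle hYhs hAu hl,
            vecMul_mul_unip hle hYhs hAu (hl.trans hb.symm), vecMul_mul_unip hle hY hh hl,
            vecMul_mul_unip hle hY hh (hl.trans hb.symm)]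
          have := hYd' l z hl
          rwa [vecMul_mul_transvection, if_pos rfl] at this
        · have h2 := hA2 l hz hl
          have h3 := abs_le.1 (hK l)
          rw [vecMul_mul_transvection, if_pos rfl, vecMul_mul_colAdd _ _ _ _ x, if_neg hxy, add_zero]
          rcases hc with rfl | rfl <;> omega
      · rw [vecMul_mul_transvection, if_neg hzy, add_zero]; exact h1
    have hqF : Y * h * colAdd A y ∈ F Y :=
      ⟨hY, hq, h * colAdd A y, mul_mem_unip hle hh hAu, Matrix.mul_assoc _ _ _⟩
    have hqF' : Y * h * colAdd A y * transvection x y c ∈ F (Y * transvection x y c) := by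
      refine ⟨hY', hq', transvection x y (-c) * (h * colAdd A y) * transvection x y c,
        conj_mem_unip (mul_mem_unip hle hh hAu) hxy hb c, ?_⟩
      have h1 : transvection x y c * transvection x y (-c) = (1 : Mat n n) := by
        rw [transvection_mul_transvection_same _ _ hxy]; simp
      calc Y * h * colAdd A y * transvection x y c
          = Y * (transvection x y c * transvection x y (-c)) * (h * colAdd A y)
            * transvection x y c := by rw [h1, Matrix.mul_one]; simp only [Matrix.mul_assoc]
        _ = _ := by simp only [Matrix.mul_assoc]
    refine (hrefl _ p hp _ hqF).trans (ReflTransGen.head ?_ (hrefl _ _ hqF' p' hp'))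
    exact ⟨hq, hq', x, y, hxy, (congrArg (le x.1) hb).mp (hle.refl _), c, hc, rfl⟩

end Positive

/-! ### Rank two from the Smith normal form -/

section Rank

variable {k l : ℕ}

/-- Some `2 × 2` minor does not vanish. -/
def HasMinor {ι κ : Type*} (A : Matrix ι κ ℤ) : Prop :=
  ∃ r s a b, A r a * A s b ≠ A r b * A s a

/-- Two vectors are linearly independent. -/
def Indep {κ : Type*} (u w : κ → ℤ) : Prop := ∃ a b, u a * w b ≠ u b * w a

theorem HasMinor.of_mul_left {ι ι' κ : Type*} [Fintype ι'] {X : Matrix ι ι' ℤ} {A : Matrix ι' κ ℤ}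
    (h : HasMinor (X * A)) : HasMinor A := by
  by_contra hA
  simp only [HasMinor, not_exists, not_not] at hA
  obtain ⟨r, s, a, b, hne⟩ := h
  apply hne
  simp only [Matrix.mul_apply, Finset.sum_mul_sum]
  refine Finset.sum_congr rfl fun p _ => Finset.sum_congr rfl fun q _ => ?_
  linear_combination X r p * X s q * hA p q a b

theorem HasMinor.transpose {ι κ : Type*} {A : Matrix ι κ ℤ} (h : HasMinor A) : HasMinor Aᵀ := by
  obtain ⟨r, s, a, b, hne⟩ := h
  refine ⟨a, b, r, s, ?_⟩
  simp only [Matrix.transpose_apply]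
  rwa [mul_comm (A s a)]

theorem HasMinor.of_mul_right {ι κ κ' : Type*} [Fintype κ] {A : Matrix ι κ ℤ} {Y : Matrix κ κ' ℤ}
    (h : HasMinor (A * Y)) : HasMinor A := by
  have := h.transpose
  rw [Matrix.transpose_mul] at this
  exact this.of_mul_left.transpose

/-- Two diagonal ones lie in different rows and columns and form a nonzero minor of `D`. If all such
minors of `A` vanished, so would those of `X A Y`. -/
theorem SmithHasTwoOnes.hasMinor {A : Matrix (Fin k) (Fin l) ℤ} (h : SmithHasTwoOnes A) :
    HasMinor A := by
  obtain ⟨D, ⟨⟨X, Y, hXY⟩, hdiag, -, -⟩, hcard⟩ := h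
  have hD : HasMinor D := by
    obtain ⟨p, hp, q, hq, hpq⟩ := Finset.one_lt_card.1 hcard
    simp only [Finset.mem_filter, Finset.mem_univ, true_and] at hp hq
    have hp' : (p.1 : ℕ) = p.2 := by
      by_contra hne; rw [hdiag _ _ hne] at hp; omega
    have hq' : (q.1 : ℕ) = q.2 := by
      by_contra hne; rw [hdiag _ _ hne] at hq; omega
    have hne : (p.1 : ℕ) ≠ q.2 := by
      intro h
      apply hpq
      refine Prod.ext (Fin.ext ?_) (Fin.ext ?_) <;> omega
    refine ⟨p.1, q.1, p.2, q.2, ?_⟩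
    rw [hp, hq, hdiag p.1 q.2 hne]
    simp
  rw [← hXY] at hD
  exact hD.of_mul_right.of_mul_left

theorem SmithHasTwoOnes.mul {A : Matrix (Fin k) (Fin l) ℤ} (h : SmithHasTwoOnes A)
    {P : Matrix (Fin k) (Fin k) ℤ} {Q : Matrix (Fin l) (Fin l) ℤ} (hP : P.det = 1)
    (hQ : Q.det = 1) : SmithHasTwoOnes (P * A * Q) := by
  obtain ⟨D, ⟨⟨X, Y, hXY⟩, hrest⟩, hcard⟩ := h
  obtain ⟨P, rfl⟩ : IsUnit P := (Matrix.isUnit_iff_isUnit_det P).2 (hP ▸ isUnit_one)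
  obtain ⟨Q, rfl⟩ : IsUnit Q := (Matrix.isUnit_iff_isUnit_det Q).2 (hQ ▸ isUnit_one)
  refine ⟨D, ⟨⟨X * P⁻¹, Q⁻¹ * Y, ?_⟩, hrest⟩, hcard⟩
  rw [← hXY, Units.val_mul, Units.val_mul]
  calc _ = (X : Matrix (Fin k) (Fin k) ℤ) *
          (((P⁻¹ : (Matrix (Fin k) (Fin k) ℤ)ˣ) : Matrix (Fin k) (Fin k) ℤ) * (P : Matrix (Fin k) (Fin k) ℤ)) * A
          * ((Q : Matrix (Fin l) (Fin l) ℤ) * ((Q⁻¹ : (Matrix (Fin l) (Fin l) ℤ)ˣ) : Matrix (Fin l) (Fin l) ℤ))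
          * (Y : Matrix (Fin l) (Fin l) ℤ) := by
        simp only [Matrix.mul_assoc]
    _ = _ := by
        rw [Units.inv_mul, Units.mul_inv, Matrix.mul_one, Matrix.mul_one]

theorem Indep.symm {κ : Type*} {u w : κ → ℤ} (h : Indep u w) : Indep w u := by
  obtain ⟨a, b, hab⟩ := h
  refine ⟨b, a, fun h => hab ?_⟩
  linear_combination h

theorem Indep.exists_ne_zero {κ : Type*} {u w : κ → ℤ} (h : Indep u w) : ∃ c, u c ≠ 0 := by
  obtain ⟨a, b, hab⟩ := h
  by_contra! h0
  exact hab (by rw [h0 a, h0 b]; ring)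

/-- Dependence on a nonzero vector is transitive. -/
theorem Indep.or {κ : Type*} {u w z : κ → ℤ} (h : Indep w z) {c : κ} (hc : u c ≠ 0) :
    Indep u w ∨ Indep u z := by
  by_contra! hcon
  simp only [Indep, not_exists, not_not] at hcon
  obtain ⟨a, b, hab⟩ := h
  have h1 : u c * u c * (w a * z b - w b * z a) = 0 := by
    have e1 := hcon.1 c a
    have e2 := hcon.2 c b
    have e3 := hcon.1 c b
    have e4 := hcon.2 c a
    linear_combination (u c * z b) * e1 + u a * w c * e2 - u c * z a * e3 - u b * w c * e4
  rcases mul_eq_zero.1 h1 with h2 | h2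
  · exact hc (mul_self_eq_zero.1 h2)
  · exact hab (by linarith)

theorem HasMinor.exists_indep {ι κ : Type*} {A : Matrix ι κ ℤ} (h : HasMinor A) {r : ι} {c : κ}
    (hc : A r c ≠ 0) : ∃ s, Indep (A r) (A s) := by
  obtain ⟨p, q, a, b, hab⟩ := h
  rcases Indep.or (u := A r) (w := A p) (z := A q) ⟨a, b, hab⟩ hc with h | h
  · exact ⟨p, h⟩
  · exact ⟨q, h⟩

end Rank

/-! ### Group structure of SL_𝒫 -/

section Group

variable {N : ℕ} {le : Fin N → Fin N → Prop} {m n : Fin N → ℕ}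

theorem mem_SLP_of_inv {U W : Mat n n} (hU : U ∈ MP le n n) (hW : W ∈ MP le n n) (hUW : U * W = 1)
    (hdet : ∀ i, (block U i i).det = 1) : U ∈ SLP le n :=
  ⟨⟨hU, W, hW, hUW, mul_eq_one_comm.1 hUW⟩, fun i _ => hdet i⟩

theorem one_mem_SLP (hle : IsSubOrder le) : (1 : Mat n n) ∈ SLP le n :=
  mem_SLP_of_inv (one_mem_MP hle) (one_mem_MP hle) (Matrix.one_mul _) fun i => by
    rw [block_one, Matrix.det_one]

theorem mul_mem_SLP (hle : IsSubOrder le) {U V : Mat n n} (hU : U ∈ SLP le n) (hV : V ∈ SLP le n) :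
    U * V ∈ SLP le n := by
  obtain ⟨hU1, U', hU', hUU', -⟩ := hU.1
  obtain ⟨hV1, V', hV', hVV', -⟩ := hV.1
  refine mem_SLP_of_inv (mul_mem_MP hle hU1 hV1) (mul_mem_MP hle hV' hU') ?_ fun i => ?_
  · calc U * V * (V' * U') = U * (V * V') * U' := by simp only [Matrix.mul_assoc]
      _ = 1 := by rw [hVV', Matrix.mul_one, hUU']
  · rw [block_mul hle hU1 hV1, Matrix.det_mul, det_block_of_mem_SLP hU, det_block_of_mem_SLP hV,
      one_mul]

theorem exists_inv_SLP (hle : IsSubOrder le) {U : Mat n n} (hU : U ∈ SLP le n) :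
    ∃ W ∈ SLP le n, U * W = 1 := by
  obtain ⟨hU1, W, hW, hUW, hWU⟩ := hU.1
  refine ⟨W, mem_SLP_of_inv hW hU1 hWU fun i => ?_, hUW⟩
  have := congrArg (fun X => (block X i i).det) hUW
  simpa [block_mul hle hU1 hW, block_one, Matrix.det_mul, det_block_of_mem_SLP hU] using this

theorem unip_subset_SLP (hle : IsSubOrder le) : unip le n ⊆ SLP le n := by
  intro h hh
  obtain ⟨g, hg, hhg⟩ := exists_inv_unip hle hh
  refine mem_SLP_of_inv (unip_subset_MP hle hh) (unip_subset_MP hle hg) hhg fun i => ?_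
  rw [((mem_unip_iff hle).1 hh).2, Matrix.det_one]

theorem blockDiagonal'_mem_SLP (hle : IsSubOrder le) {δ : ∀ i, Matrix (Fin (n i)) (Fin (n i)) ℤ}
    (hδ : ∀ i, (δ i).det = 1) : (Matrix.blockDiagonal' δ : Mat n n) ∈ SLP le n := by
  refine mem_SLP_of_inv (blockDiagonal'_mem_MP hle δ)
    (blockDiagonal'_mem_MP hle fun i => (δ i)⁻¹) ?_ fun i => ?_
  · rw [← Matrix.blockDiagonal'_mul]
    have : (fun i => δ i * (δ i)⁻¹) = (1 : ∀ i, Matrix (Fin (n i)) (Fin (n i)) ℤ) := by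
      funext i
      exact Matrix.mul_nonsing_inv _ (by rw [hδ]; exact isUnit_one)
    rw [this, Matrix.blockDiagonal'_one]
  · rw [block_blockDiagonal', hδ]

theorem transvection_mem_SLP (hle : IsSubOrder le) {x y : Idx n} (hne : x ≠ y)
    (hxy : le x.1 y.1) (c : ℤ) : transvection x y c ∈ SLP le n := by
  refine mem_SLP_of_inv (transvection_mem_MP hle hxy c) (transvection_mem_MP hle hxy (-c)) ?_
    fun i => ?_
  · rw [transvection_mul_transvection_same _ _ hne]; simp
  · have hval : ∀ a b : Idx n, transvection x y c a b
        = (1 : Mat n n) a b + if a = x then c * (1 : Mat n n) y b else 0 := by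
      intro a b
      rw [← transvection_mul_apply, Matrix.mul_one]
    obtain ⟨p, s⟩ := x
    obtain ⟨q, t⟩ := y
    by_cases hi : i = p ∧ i = q
    · obtain ⟨rfl, rfl⟩ := hi
      have hst : s ≠ t := by rintro rfl; exact hne rfl
      have : block (transvection (⟨i, s⟩ : Idx n) ⟨i, t⟩ c) i i = transvection s t c := by
        ext a b
        have h := transvection_mul_apply s t c (1 : Matrix (Fin (n i)) (Fin (n i)) ℤ) a b
        rw [Matrix.mul_one] at h
        rw [h]
        simp [block, hval, Matrix.one_apply]
      rw [this, det_transvection_of_ne _ _ hst]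
    · have : block (transvection (⟨p, s⟩ : Idx n) ⟨q, t⟩ c) i i = 1 := by
        rw [← block_one]
        ext a b
        simp only [block, Matrix.of_apply, hval]
        rw [add_eq_left]
        split_ifs with h
        · rw [Matrix.one_apply_ne, mul_zero]
          intro h'
          exact hi ⟨congrArg Sigma.fst h, (congrArg Sigma.fst h').symm⟩
        · rfl
      rw [this, Matrix.det_one]

end Group

/-! ### Good pairs and choices of rows -/

section Main

variable {N : ℕ} {le : Fin N → Fin N → Prop} {m n : Fin N → ℕ} {B : Mat m n}

/-- The positions in which the elements of `𝔐⁺_𝒫` have to be positive. -/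
abbrev allowed (le : Fin N → Fin N → Prop) (m n : Fin N → ℕ) : Idx m → Idx n → Prop :=
  fun x y => le x.1 y.1

/-- The pairs `(U, V)` such that `U B V` is positive. -/
def goodSet (le : Fin N → Fin N → Prop) (B : Mat m n) : Set (Mat m m × Mat n n) :=
  {p | p.1 ∈ SLP le m ∧ p.2 ∈ SLP le n ∧ p.1 ∈ posSet (allowed le m n) (B * p.2)}

/-- One elementary row or column operation between pairs in `goodSet`. -/
def GoodStep (le : Fin N → Fin N → Prop) (B : Mat m n) (p q : Mat m m × Mat n n) : Prop :=
  p ∈ goodSet le B ∧ q ∈ goodSet le B ∧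
    ((p.2 = q.2 ∧ RowStep (allowed le m m) Set.univ p.1 q.1) ∨
      (p.1 = q.1 ∧ ColStep (allowed le n n) Set.univ p.2 q.2))

abbrev GoodConn (le : Fin N → Fin N → Prop) (B : Mat m n) := ReflTransGen (GoodStep le B)

theorem goodConn_of_rowConn (hle : IsSubOrder le) {U U' : Mat m m} {V : Mat n n}
    (hU : U ∈ SLP le m) (hV : V ∈ SLP le n)
    (h : RowConn (allowed le m m) (posSet (allowed le m n) (B * V)) U U') :
    GoodConn le B (U, V) (U', V) := by
  have h1 := (rowConn_restrict (I := SLP le m) (fun X hX x y hne hxy c =>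
    mul_mem_SLP hle (transvection_mem_SLP hle hne hxy c) hX) h hU).1
  refine ReflTransGen.lift (fun X => (X, V)) ?_ _ _ h1
  rintro X Y ⟨hX, hY, hstep⟩
  exact ⟨⟨hX.2, hV, hX.1⟩, ⟨hY.2, hV, hY.1⟩, Or.inl ⟨rfl, trivial, trivial, hstep⟩⟩

/-- Diagonal blocks multiply, and those of the two factors have determinant 1, so the Smith
condition persists. -/
theorem MPplus_of_mem_goodSet (hle : IsSubOrder le) (hB : B ∈ MPplus le m n)
    {p : Mat m m × Mat n n} (hp : p ∈ goodSet le B) : p.1 * B * p.2 ∈ MPplus le m n := by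
  obtain ⟨hU, hV, hpos⟩ := hp
  have hpos' : ∀ i j, le i j → Pos (block (p.1 * B * p.2) i j) := by
    intro i j hij a b
    have := hpos ⟨i, a⟩ ⟨j, b⟩ hij
    rwa [← Matrix.mul_assoc] at this
  have hUB := mul_mem_MP hle hU.1.1 hB.1
  refine ⟨mul_mem_MP hle hUB hV.1.1, fun i j hij _ _ => hpos' i j hij, fun i hm hn => ?_⟩
  obtain ⟨-, h1, h2, h3⟩ := hB.2.2 i hm hn
  refine ⟨hpos' i i (hle.refl i), ?_, h2, h3⟩
  rw [block_mul hle hUB hV.1.1, block_mul hle hU.1.1 hB.1]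
  exact h1.mul (det_block_of_mem_SLP hU i) (det_block_of_mem_SLP hV i)

theorem positiveChain_of_goodConn (hle : IsSubOrder le) (hB : B ∈ MPplus le m n)
    {p : Mat m m × Mat n n} (h : GoodConn le B (1, 1) p) : PositiveChain le B p.1 p.2 := by
  induction h with
  | refl => exact .refl hB
  | @tail p q _ hs ih =>
    obtain ⟨-, hq, hs⟩ := hs
    have hq' := MPplus_of_mem_goodSet hle hB hq
    obtain ⟨U, V⟩ := p
    obtain ⟨U', V'⟩ := q
    rcases hs with ⟨h1, -, -, x, y, hne, hxy, c, hc, h2⟩ | ⟨h1, -, -, x, y, hne, hxy, c, hc, h2⟩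
    · simp only at h1 h2 hq' ih ⊢
      subst h1 h2
      exact .left _ _ _ ih ⟨x, y, hne, c, hc, rfl⟩ (transvection_mem_SLP hle hne hxy c) hq'
    · simp only at h1 h2 hq' ih ⊢
      subst h1 h2
      exact .right _ _ _ ih ⟨x, y, hne, c, hc, rfl⟩ (transvection_mem_SLP hle hne hxy c) hq'

/-- The row operations which leave the rows in `R` unchanged. -/
abbrev offRows (le : Fin N → Fin N → Prop) (R : Set (Idx m)) : Idx m → Idx m → Prop :=
  fun x y => allowed le m m x y ∧ x ∉ R

theorem row_eq_of_rowConn {κ : Type*} {R : Set (Idx m)} {U U' : Mat m m}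
    (h : RowConn (offRows le R) Set.univ U U') (C : Matrix (Idx m) κ ℤ) {x : Idx m} (hx : x ∈ R) :
    (U' * C) x = (U * C) x := by
  refine (rowConn_restrict (I := {X : Mat m m | (X * C) x = (U * C) x}) ?_ h
    (show (U * C) x = (U * C) x from rfl)).2
  intro X hX a b _ hab c
  simp only [Set.mem_ofPred_eq] at hX ⊢
  rw [← hX]
  funext z
  rw [Matrix.mul_assoc, transvection_mul_apply, if_neg (by rintro rfl; exact hab.2 hx), add_zero]

theorem mem_SLP_of_rowConn (hle : IsSubOrder le) {R : Set (Idx m)} {U U' : Mat m m}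
    (h : RowConn (offRows le R) Set.univ U U') (hU : U ∈ SLP le m) : U' ∈ SLP le m :=
  (rowConn_restrict (I := SLP le m) (fun _ hX _ _ hne hxy c =>
    mul_mem_SLP hle (transvection_mem_SLP hle hne hxy.1 c) hX) h hU).2

theorem mem_suppSet (hle : IsSubOrder le) (hB : B ∈ MP le m n) {U : Mat m m} {V : Mat n n}
    (hU : U ∈ SLP le m) (hV : V ∈ SLP le n) : U ∈ suppSet (allowed le m n) (B * V) :=
  mem_MP_iff.1 (mul_mem_MP hle hU.1.1 (mul_mem_MP hle hB hV.1.1))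

theorem goodConn_of_pivot (hle : IsSubOrder le) (hB : B ∈ MP le m n) {R : Set (Idx m)}
    (hR : ∀ x : Idx m, ∃ y ∈ R, y.1 = x.1) {U U' : Mat m m} {V : Mat n n}
    (hU : (U, V) ∈ goodSet le B) (hU' : (U', V) ∈ goodSet le B)
    (h : RowConn (offRows le R) Set.univ U U') : GoodConn le B (U, V) (U', V) := by
  refine goodConn_of_rowConn hle hU.1 hU.2.1 (rowConn_posSet_of_pivot (R := R)
    (fun x y z h1 h2 => hle.trans _ _ _ h1 h2) (fun x y z h1 h2 => hle.trans _ _ _ h1 h2)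
    (fun x _ => ?_) (mem_suppSet hle hB hU.1 hU.2.1) hU.2.2 hU'.2.2 h)
  obtain ⟨y, hy, hyx⟩ := hR x
  exact ⟨y, hy, by rw [allowed, hyx]; exact hle.refl _, fun z hz => by rw [allowed, hyx]; exact hz⟩

/-- If `R` contains exactly one row of every block, then pairs in `goodSet` whose first components
differ by row operations leaving the rows in `R` unchanged are connected. -/
theorem goodConn_of_transversal (hle : IsSubOrder le) (hB : B ∈ MPplus le m n)
    (hn : ∀ i, n i ≠ 0) {R : Set (Idx m)} (hR : ∀ x : Idx m, ∃ y ∈ R, y.1 = x.1)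
    (hR1 : ∀ x ∈ R, ∀ y ∈ R, x.1 = y.1 → x = y) {U U' : Mat m m} {W W' : Mat n n}
    (hU : (U, W) ∈ goodSet le B) (hU' : (U', W') ∈ goodSet le B)
    (h : RowConn (offRows le R) Set.univ U U') : GoodConn le B (U, W) (U', W') := by
  obtain ⟨Y, hY, hWY⟩ := exists_inv_SLP hle hU.2.1
  have hX : W * (Y * W') = W' := by rw [← Matrix.mul_assoc, hWY, Matrix.one_mul]
  have hXS := mul_mem_SLP hle hY hU'.2.1
  let v : {x // x ∈ R} → Idx n → ℤ := fun l => (U * B) l.1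
  let blk : {x // x ∈ R} → Fin N := fun l => l.1.1
  have hv : ∀ l (Z : Mat n n), v l ᵥ* Z = (U * (B * Z)) l.1 := by
    intro l Z
    rw [← Matrix.mul_assoc]
    rfl
  have hpath := colConn_fullPos (v := v) (blk := blk) hle
    (fun x y hxy => Subtype.ext (hR1 _ x.2 _ y.2 hxy))
    (fun l => (hB.2.2 l.1.1 (by have := l.1.2.isLt; omega) (hn _)).2.2.1) (W := W) (X := Y * W')
    (fun l y hy => by
      rw [hv] at hy; exact mem_suppSet hle hB.1 hU.1 hU.2.1 _ _ hy)
    (fun l y hy => by rw [hv]; exact hU.2.2 _ _ hy) hXS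
    (fun l y hy => by
      rw [hX, hv, ← row_eq_of_rowConn h (B * W') l.2]; exact hU'.2.2 _ _ hy)
  rw [hX] at hpath
  have key : ∀ Z, ColConn (fun x y => le x.1 y.1) (fullPos le v blk) W Z →
      ∃ U1, RowConn (offRows le R) Set.univ U U1 ∧ (U1, Z) ∈ goodSet le B ∧
        GoodConn le B (U, W) (U1, Z) := by
    intro Z hZ
    induction hZ with
    | refl => exact ⟨U, .refl, hU, .refl⟩
    | @tail Z _ _ hs ih =>
      obtain ⟨hZ1, hZ2, x, y, hne, hxy, c, hc, rfl⟩ := hs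
      obtain ⟨U1, hc1, hg1, hconn⟩ := ih
      have hZS : Z * transvection x y c ∈ SLP le n :=
        mul_mem_SLP hle hg1.2.1 (transvection_mem_SLP hle hne hxy c)
      -- With the matrices before and after the column operation placed side by side, the same
      -- multiples of rows in `R` make both positive.
      obtain ⟨U2, hc2, hp2⟩ := exists_rowConn_posSet (r := allowed le m m) (R := R) (U := U1)
        (C := Matrix.fromCols (B * Z) (B * (Z * transvection x y c)))
        (s := fun x z => Sum.elim (allowed le m n x) (allowed le m n x) z)
        (fun x _ => by
          obtain ⟨y, hy, hyx⟩ := hR x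
          refine ⟨y, hy, by rw [allowed, hyx]; exact hle.refl _, ?_⟩
          rintro (z | z) hz
          · simpa only [Sum.elim_inl, allowed, hyx] using hz
          · simpa only [Sum.elim_inr, allowed, hyx] using hz)
        (by
          rw [Matrix.mul_fromCols]
          rintro l hl (z | z) hz
          · rw [Matrix.fromCols_apply_inl, row_eq_of_rowConn hc1 _ hl, ← hv ⟨l, hl⟩]
            exact hZ1 ⟨l, hl⟩ z hz
          · rw [Matrix.fromCols_apply_inr, row_eq_of_rowConn hc1 _ hl, ← hv ⟨l, hl⟩]
            exact hZ2 ⟨l, hl⟩ z hz)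
      have hU2 := mem_SLP_of_rowConn hle hc2 hg1.1
      rw [posSet, Set.mem_ofPred_eq, Matrix.mul_fromCols] at hp2
      have hg2 : (U2, Z) ∈ goodSet le B := ⟨hU2, hg1.2.1, fun a z hz => by
        have := hp2 a (Sum.inl z) hz
        rwa [Matrix.fromCols_apply_inl] at this⟩
      have hg3 : (U2, Z * transvection x y c) ∈ goodSet le B := ⟨hU2, hZS, fun a z hz => by
        have := hp2 a (Sum.inr z) hz
        rwa [Matrix.fromCols_apply_inr] at this⟩
      refine ⟨U2, hc1.trans hc2, hg3, (hconn.trans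
        (goodConn_of_pivot hle hB.1 hR hg1 hg2 hc2)).tail ⟨hg2, hg3, Or.inr ⟨rfl, ?_⟩⟩⟩
      exact ⟨trivial, trivial, x, y, hne, hxy, c, hc, rfl⟩
  obtain ⟨U1, hc1, hg1, hconn⟩ := key W' hpath
  exact hconn.trans (goodConn_of_pivot hle hB.1 hR hg1 hU' ((rowConn_symm hc1).trans h))

/-- If the diagonal parts of the rows in `R` can be made positive, then there is a pair
in `goodSet`. -/
theorem exists_goodSet (hle : IsSubOrder le) (hB : B ∈ MP le m n)
    (hn : ∀ i, n i ≠ 0) {R : Set (Idx m)} (hR : ∀ x : Idx m, ∃ y ∈ R, y.1 = x.1) {U : Mat m m}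
    (hU : U ∈ SLP le m) (hδ : ∀ i, ∃ δ : Matrix (Fin (n i)) (Fin (n i)) ℤ, δ.det = 1 ∧
      ∀ x ∈ R, x.1 = i → ∀ a, 0 < ((fun b => (U * B) x ⟨i, b⟩) ᵥ* δ) a) :
    ∃ p ∈ goodSet le B, RowConn (offRows le R) Set.univ U p.1 := by
  choose δ hδ1 hδ2 using hδ
  let v : {x // x ∈ R} → Idx n → ℤ := fun l => (U * B) l.1
  let blk : {x // x ∈ R} → Fin N := fun l => l.1.1
  have hv : ∀ l (Z : Mat n n), v l ᵥ* Z = (U * (B * Z)) l.1 := by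
    intro l Z
    rw [← Matrix.mul_assoc]
    rfl
  have hW0 := blockDiagonal'_mem_SLP hle hδ1
  obtain ⟨h, hh, hpos⟩ := exists_unip_fullPos (v := v) (blk := blk) hle (fun l => hn _)
    (W := Matrix.blockDiagonal' δ)
    (fun l y hy => by rw [hv] at hy; exact mem_suppSet hle hB hU hW0 _ _ hy)
    (by
      rintro l ⟨i, a⟩ hi
      rw [vecMul_blockDiagonal']
      exact hδ2 i l.1 l.2 hi a)
  have hW := mul_mem_SLP hle hW0 (unip_subset_SLP hle hh)
  obtain ⟨U1, hc, hp⟩ := exists_rowConn_posSet (r := allowed le m m) (R := R) (U := U)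
    (C := B * (Matrix.blockDiagonal' δ * h)) (s := allowed le m n)
    (fun x _ => by
      obtain ⟨y, hy, hyx⟩ := hR x
      exact ⟨y, hy, by rw [allowed, hyx]; exact hle.refl _, fun z hz => by
        rw [allowed, hyx]; exact hz⟩)
    (fun l hl z hz => by rw [← hv ⟨l, hl⟩]; exact hpos ⟨l, hl⟩ z hz)
  exact ⟨(U1, _), ⟨mem_SLP_of_rowConn hle hc hU, hW, hp⟩, hc⟩

/-- A choice of one row in every nonempty block. -/
abbrev RowChoice (m : Fin N → ℕ) := ∀ i, m i ≠ 0 → Fin (m i)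

/-- The set of the chosen rows. -/
def RowChoice.rows (ρ : RowChoice m) : Set (Idx m) := {x | ∀ h : m x.1 ≠ 0, x.2 = ρ x.1 h}

theorem Idx.ne_zero (x : Idx m) : m x.1 ≠ 0 := by have := x.2.isLt; omega

theorem RowChoice.mem_rows (ρ : RowChoice m) (i : Fin N) (h : m i ≠ 0) :
    (⟨i, ρ i h⟩ : Idx m) ∈ ρ.rows := fun _ => rfl

theorem RowChoice.exists_rows (ρ : RowChoice m) (x : Idx m) : ∃ y ∈ ρ.rows, y.1 = x.1 :=
  ⟨⟨x.1, ρ x.1 x.ne_zero⟩, ρ.mem_rows _ _, rfl⟩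

theorem RowChoice.rows_inj (ρ : RowChoice m) : ∀ x ∈ ρ.rows, ∀ y ∈ ρ.rows, x.1 = y.1 → x = y := by
  rintro ⟨i, a⟩ hx ⟨j, b⟩ hy hij
  simp only at hij
  subst hij
  have h : m i ≠ 0 := Idx.ne_zero ⟨i, a⟩
  have h1 : a = ρ i h := hx h
  have h2 : b = ρ i h := hy h
  rw [h1, h2]

/-- The diagonal part of the row `a` of block `i` of `U B`. -/
def diagRow (B : Mat m n) (U : Mat m m) (i : Fin N) (a : Fin (m i)) : Fin (n i) → ℤ :=
  fun b => (U * B) ⟨i, a⟩ ⟨i, b⟩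

/-- The chosen rows of `U B` have nonzero diagonal part. -/
def RowChoice.Valid (B : Mat m n) (U : Mat m m) (ρ : RowChoice m) : Prop :=
  ∀ i h, ∃ b, diagRow B U i (ρ i h) b ≠ 0

theorem hasMinor_diagRow (hle : IsSubOrder le) (hB : B ∈ MPplus le m n) (hn : ∀ i, n i ≠ 0)
    {U : Mat m m} (hU : U ∈ SLP le m) {i : Fin N} (hi : m i ≠ 0) :
    HasMinor (Matrix.of (diagRow B U i)) := by
  have h1 := (hB.2.2 i hi (hn i)).2.1.mul (det_block_of_mem_SLP hU i) (Matrix.det_one)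
  rw [Matrix.mul_one, ← block_mul hle hU.1.1 hB.1] at h1
  exact h1.hasMinor

theorem exists_indep_diagRow (hle : IsSubOrder le) (hB : B ∈ MPplus le m n) (hn : ∀ i, n i ≠ 0)
    {U : Mat m m} (hU : U ∈ SLP le m) {i : Fin N} {a : Fin (m i)} {c : Fin (n i)}
    (hc : diagRow B U i a c ≠ 0) : ∃ b, Indep (diagRow B U i a) (diagRow B U i b) :=
  (hasMinor_diagRow hle hB hn hU (Idx.ne_zero ⟨i, a⟩)).exists_indep (r := a) hc

/-- Two choices of rows agree or are linearly independent in every block. -/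
def RowChoice.Compat (B : Mat m n) (U : Mat m m) (ρ ρ' : RowChoice m) : Prop :=
  ∀ i h, ρ i h = ρ' i h ∨ Indep (diagRow B U i (ρ i h)) (diagRow B U i (ρ' i h))

/-- In each nonempty block one or two chosen rows must become positive together. Two distinct ones
are independent, so one matrix of determinant 1 serves both; if the choices agree, any row
independent of the common one fills the second place. -/
theorem exists_goodSet_of_compat (hle : IsSubOrder le) (hB : B ∈ MPplus le m n)
    (hn : ∀ i, n i ≠ 0) {U : Mat m m} (hU : U ∈ SLP le m) {ρ ρ' : RowChoice m}
    (hρ : ρ.Valid B U) (hc : ρ.Compat B U ρ') :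
    ∃ p ∈ goodSet le B, RowConn (offRows le (ρ.rows ∪ ρ'.rows)) Set.univ U p.1 := by
  refine exists_goodSet hle hB.1 hn (fun x => ?_) hU fun i => ?_
  · obtain ⟨y, hy, hyx⟩ := ρ.exists_rows x
    exact ⟨y, Or.inl hy, hyx⟩
  · by_cases hi : m i = 0
    · refine ⟨1, Matrix.det_one, ?_⟩
      rintro x _ rfl
      exact absurd hi x.ne_zero
    obtain ⟨b, hb, hb'⟩ : ∃ b, Indep (diagRow B U i (ρ i hi)) (diagRow B U i b) ∧
        (ρ' i hi = ρ i hi ∨ ρ' i hi = b) := by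
      rcases hc i hi with h | h
      · obtain ⟨c, hc⟩ := hρ i hi
        obtain ⟨b, hb⟩ := exists_indep_diagRow hle hB hn hU hc
        exact ⟨b, hb, Or.inl h.symm⟩
      · exact ⟨_, h, Or.inr rfl⟩
    obtain ⟨_, _, hne⟩ := hb
    obtain ⟨δ, h1, h2, h3⟩ := exists_vecMul_pair hne
    refine ⟨δ, h1, ?_⟩
    rintro ⟨j, a⟩ hx hj
    simp only at hj
    subst hj
    have ha : a = ρ j hi ∨ a = b := by
      rcases hx with hx | hx
      · exact Or.inl (hx hi)
      · have h4 : a = ρ' j hi := hx hi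
        rw [h4]; exact hb'
    rcases ha with rfl | rfl
    · exact h2
    · exact h3

/-- Steps between elements of `SL_𝒫` with a choice of rows, which either change the choice to a
compatible one or leave the chosen rows unchanged. -/
def ChoiceStep (le : Fin N → Fin N → Prop) (B : Mat m n) (q q' : Mat m m × RowChoice m) : Prop :=
  q.1 ∈ SLP le m ∧ q'.1 ∈ SLP le m ∧ q.2.Valid B q.1 ∧ q'.2.Valid B q'.1 ∧
    ((q.1 = q'.1 ∧ q.2.Compat B q.1 q'.2) ∨
      (q.2 = q'.2 ∧ RowConn (offRows le q.2.rows) Set.univ q.1 q'.1))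

theorem RowChoice.compat_self (B : Mat m n) (U : Mat m m) (ρ : RowChoice m) : ρ.Compat B U ρ :=
  fun _ _ => Or.inl rfl

/-- If two nonzero rows are dependent, a row independent of one is independent of the other, so one
intermediate choice suffices. -/
theorem choiceStep_change (hle : IsSubOrder le) (hB : B ∈ MPplus le m n) (hn : ∀ i, n i ≠ 0)
    {U : Mat m m} (hU : U ∈ SLP le m) {ρ ρ' : RowChoice m}
    (hρ : ρ.Valid B U) (hρ' : ρ'.Valid B U) :
    ReflTransGen (ChoiceStep le B) (U, ρ) (U, ρ') := by
  have : ∀ i h, ∃ a, (∃ c, diagRow B U i a c ≠ 0) ∧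
      (ρ i h = a ∨ Indep (diagRow B U i (ρ i h)) (diagRow B U i a)) ∧
      (a = ρ' i h ∨ Indep (diagRow B U i a) (diagRow B U i (ρ' i h))) := by
    intro i h
    by_cases hind : Indep (diagRow B U i (ρ i h)) (diagRow B U i (ρ' i h))
    · exact ⟨ρ i h, hρ i h, Or.inl rfl, Or.inr hind⟩
    · obtain ⟨c, hc⟩ := hρ i h
      obtain ⟨c', hc'⟩ := hρ' i h
      obtain ⟨b, hb⟩ := exists_indep_diagRow hle hB hn hU hc
      refine ⟨b, hb.symm.exists_ne_zero, Or.inr hb, Or.inr ?_⟩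
      rcases hb.or hc' with h1 | h1
      · exact absurd h1.symm hind
      · exact h1.symm
  choose ρ1 h1 h2 h3 using this
  exact .head (b := (U, ρ1)) ⟨hU, hU, hρ, h1, Or.inl ⟨rfl, h2⟩⟩
    (.single ⟨hU, hU, h1, hρ', Or.inl ⟨rfl, h3⟩⟩)

theorem exists_valid_avoiding (hle : IsSubOrder le) (hB : B ∈ MPplus le m n) (hn : ∀ i, n i ≠ 0)
    {U : Mat m m} (hU : U ∈ SLP le m) (x : Idx m) :
    ∃ ρ : RowChoice m, ρ.Valid B U ∧ x ∉ ρ.rows := by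
  have : ∀ i, m i ≠ 0 → ∃ a : Fin (m i), (∃ c, diagRow B U i a c ≠ 0) ∧ (⟨i, a⟩ : Idx m) ≠ x := by
    intro i hi
    obtain ⟨r, s, a, b, hne⟩ := hasMinor_diagRow hle hB hn hU hi
    have hind : Indep (diagRow B U i r) (diagRow B U i s) := ⟨a, b, hne⟩
    have hrs : r ≠ s := by
      rintro rfl; exact hne (mul_comm _ _)
    by_cases hr : (⟨i, r⟩ : Idx m) = x
    · refine ⟨s, hind.symm.exists_ne_zero, ?_⟩
      rw [← hr]
      intro h
      exact hrs (by simpa using h.symm)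
    · exact ⟨r, hind.exists_ne_zero, hr⟩
  choose ρ h1 h2 using this
  refine ⟨ρ, h1, fun hx => h2 x.1 x.ne_zero ?_⟩
  exact Sigma.ext rfl (heq_of_eq (hx x.ne_zero).symm)

/-- Only row `x` changes, so the operation is made under a valid choice avoiding `x`, with changes
of choice before and after. -/
theorem choiceStep_transvection (hle : IsSubOrder le) (hB : B ∈ MPplus le m n) (hn : ∀ i, n i ≠ 0)
    {U : Mat m m} (hU : U ∈ SLP le m) {x y : Idx m} (hne : x ≠ y) (hxy : le x.1 y.1) {c : ℤ}
    {ρ ρ' : RowChoice m} (hρ : ρ.Valid B U)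
    (hρ' : ρ'.Valid B (transvection x y c * U)) :
    ReflTransGen (ChoiceStep le B) (U, ρ) (transvection x y c * U, ρ') := by
  obtain ⟨ρ1, hρ1, hx⟩ := exists_valid_avoiding hle hB hn hU x
  have hU' := mul_mem_SLP hle (transvection_mem_SLP hle hne hxy c) hU
  have hconn : RowConn (offRows le ρ1.rows) Set.univ U (transvection x y c * U) :=
    rowConn_transvection (r := offRows le ρ1.rows) hne ⟨hxy, hx⟩ c U
  have hρ1' : ρ1.Valid B (transvection x y c * U) := by
    intro i h
    obtain ⟨b, hb⟩ := hρ1 i h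
    refine ⟨b, ?_⟩
    rwa [diagRow, row_eq_of_rowConn hconn B (ρ1.mem_rows i h)]
  exact ((choiceStep_change hle hB hn hU hρ hρ1).tail
    (b := (U, ρ1)) (c := (transvection x y c * U, ρ1))
    ⟨hU, hU', hρ1, hρ1', Or.inr ⟨rfl, hconn⟩⟩).trans (choiceStep_change hle hB hn hU' hρ1' hρ')

theorem choiceStep_connected (hle : IsSubOrder le) (hB : B ∈ MPplus le m n) (hn : ∀ i, n i ≠ 0)
    {U : Mat m m} (hU : U ∈ SLP le m) {ρ ρ' : RowChoice m} (hρ : ρ.Valid B 1)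
    (hρ' : ρ'.Valid B U) : ReflTransGen (ChoiceStep le B) (1, ρ) (U, ρ') := by
  -- The last factor of `X` acts first on `Y`, so a path of column operations on `X` yields row
  -- operations on `Y`.
  have key : ∀ X, ColConn (fun x y => le x.1 y.1) Set.univ (1 : Mat m m) X → ∀ Y ∈ SLP le m,
      ∀ ρ ρ' : RowChoice m, ρ.Valid B Y → ρ'.Valid B (X * Y) →
      ReflTransGen (ChoiceStep le B) (Y, ρ) (X * Y, ρ') := by
    intro X hX
    induction hX with
    | refl =>
      intro Y hY ρ ρ' hρ hρ'
      rw [Matrix.one_mul] at hρ' ⊢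
      exact choiceStep_change hle hB hn hY hρ hρ'
    | tail _ hs ih =>
      obtain ⟨-, -, x, y, hne, hxy, c, -, rfl⟩ := hs
      intro Y hY ρ ρ' hρ hρ'
      have hY' := mul_mem_SLP hle (transvection_mem_SLP hle hne hxy c) hY
      obtain ⟨ρ1, hρ1, -⟩ := exists_valid_avoiding hle hB hn hY' x
      rw [Matrix.mul_assoc] at hρ' ⊢
      exact (choiceStep_transvection hle hB hn hY hne hxy hρ hρ1).trans (ih _ hY' ρ1 ρ' hρ1 hρ')
  -- The empty family imposes no positivity; what remains is that elementary matrices generate SL_𝒫.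
  have hgen := colConn_fullPos (Λ := Empty) (v := fun l => l.elim) (blk := fun l => l.elim) hle
    (fun l => l.elim) (fun l => l.elim) (W := 1) (X := U) (fun l => l.elim) (fun l => l.elim) hU
    (fun l => l.elim)
  rw [Matrix.one_mul] at hgen
  have := key U (colConn_mono (fun _ _ h => h) (Set.subset_univ _) hgen) 1 (one_mem_SLP hle) ρ ρ' hρ
    (by rwa [Matrix.mul_one])
  rwa [Matrix.mul_one] at this

/-- All pairs in `goodSet` are connected to `(1, 1)`. -/
theorem goodConn_of_mem_goodSet (hle : IsSubOrder le) (hB : B ∈ MPplus le m n) (hn : ∀ i, n i ≠ 0)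
    {p : Mat m m × Mat n n} (hp : p ∈ goodSet le B) (h1 : (1, 1) ∈ goodSet le B) :
    GoodConn le B (1, 1) p := by
  let F : Mat m m × RowChoice m → Set (Mat m m × Mat n n) := fun q =>
    {p | p ∈ goodSet le B ∧ RowConn (offRows le q.2.rows) Set.univ q.1 p.1}
  have hrefl : ∀ q, ∀ p ∈ F q, ∀ p' ∈ F q, GoodConn le B p p' := fun q p hp p' hp' =>
    goodConn_of_transversal hle hB hn q.2.exists_rows q.2.rows_inj hp.1 hp'.1
      ((rowConn_symm hp.2).trans hp'.2)
  have hmono : ∀ {R R' : Set (Idx m)} {X Y : Mat m m}, R ⊆ R' →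
      RowConn (offRows le R') Set.univ X Y → RowConn (offRows le R) Set.univ X Y := fun hRR h =>
    rowConn_mono (fun _ _ h => ⟨h.1, fun h' => h.2 (hRR h')⟩) le_rfl h
  obtain ⟨ρ, hρ⟩ : ∃ ρ : RowChoice m, ρ.Valid B 1 := by
    refine ⟨fun i h => ⟨0, Nat.pos_of_ne_zero h⟩, fun i h => ⟨⟨0, Nat.pos_of_ne_zero (hn i)⟩, ?_⟩⟩
    have := h1.2.2 ⟨i, ⟨0, Nat.pos_of_ne_zero h⟩⟩ ⟨i, ⟨0, Nat.pos_of_ne_zero (hn i)⟩⟩ (hle.refl i)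
    rw [Matrix.mul_one] at this
    exact this.ne'
  obtain ⟨ρ', hρ'⟩ : ∃ ρ' : RowChoice m, ρ'.Valid B p.1 := by
    by_cases hm : Nonempty (Idx m)
    · obtain ⟨x⟩ := hm
      obtain ⟨ρ', h, -⟩ := exists_valid_avoiding hle hB hn hp.1 x
      exact ⟨ρ', h⟩
    · exact ⟨ρ, fun i h => absurd ⟨⟨i, ρ i h⟩⟩ hm⟩
  refine conn_of_fibres (conn := GoodConn le B) (fun _ _ _ h h' => h.trans h') (F := F)
    (E := ChoiceStep le B) ?_ ?_ (hrefl _) (choiceStep_connected hle hB hn hp.1 hρ hρ')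
    (1, 1) ⟨h1, .refl⟩ p ⟨hp, .refl⟩
  · rintro ⟨X, σ⟩ ⟨X', σ'⟩ ⟨-, hX', -, hσ', -⟩
    obtain ⟨q, hq, hqc⟩ := exists_goodSet_of_compat hle hB hn hX' hσ' (σ'.compat_self B X')
    exact ⟨q, hq, hmono Set.subset_union_left hqc⟩
  · rintro ⟨X, σ⟩ ⟨X', σ'⟩ ⟨hX, hX', hσ, hσ', h⟩ q hq q' hq'
    simp only at hX hX' hσ hσ' h
    have hcommon : (F (X, σ) ∩ F (X', σ')).Nonempty := by
      rcases h with ⟨rfl, h⟩ | ⟨rfl, h⟩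
      · obtain ⟨q, hq, hqc⟩ := exists_goodSet_of_compat hle hB hn hX hσ h
        exact ⟨q, ⟨hq, hmono Set.subset_union_left hqc⟩, hq, hmono Set.subset_union_right hqc⟩
      · obtain ⟨q, hq, hqc⟩ := exists_goodSet_of_compat hle hB hn hX hσ (σ.compat_self B X)
        have hqc := hmono Set.subset_union_left hqc
        exact ⟨q, ⟨hq, hqc⟩, hq, (rowConn_symm h).trans hqc⟩
    obtain ⟨t, ht, ht'⟩ := hcommon
    exact (hrefl _ q hq t ht).trans (hrefl _ t ht' q' hq')

end Main

end BlockMatrix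

theorem theorem9p10 {N : ℕ} (le : Fin N → Fin N → Prop)
    (le_refl : ∀ i, le i i)
    (le_trans : ∀ i j k, le i j → le j k → le i k)
    (le_antisymm : ∀ i j, le i j → le j i → i = j)
    (le_imp : ∀ i j, le i j → i ≤ j)
    (m n : Fin N → ℕ) (hn : ∀ i, n i ≠ 0)
    (B B' : BlockMatrix.Mat m n)
    (hB : B ∈ BlockMatrix.MPplus le m n) (hB' : B' ∈ BlockMatrix.MPplus le m n)
    (U : BlockMatrix.Mat m m) (V : BlockMatrix.Mat n n)
    (hU : U ∈ BlockMatrix.SLP le m) (hV : V ∈ BlockMatrix.SLP le n)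
    (hUBV : U * B * V = B') :
    BlockMatrix.IsPositiveEquivalence le U V B B' := by
  have hle : BlockMatrix.IsSubOrder le := ⟨le_refl, le_trans, le_antisymm, le_imp⟩
  have hpos : ∀ C ∈ BlockMatrix.MPplus le m n, ∀ x y, le x.1 y.1 → 0 < C x y :=
    fun C hC x y hxy => hC.2.1 x.1 y.1 hxy x.ne_zero (hn _) x.2 y.2
  refine ⟨hB, hB', ⟨hU, hV, hUBV⟩, BlockMatrix.positiveChain_of_goodConn hle hB (p := (U, V))
    (BlockMatrix.goodConn_of_mem_goodSet hle hB hn ⟨hU, hV, fun x y hxy => ?_⟩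
    ⟨BlockMatrix.one_mem_SLP hle, BlockMatrix.one_mem_SLP hle, fun x y hxy => ?_⟩)⟩
  · rw [← Matrix.mul_assoc, hUBV]
    exact hpos B' hB' x y hxy
  · rw [Matrix.one_mul, Matrix.mul_one]
    exact hpos B hB x y hxy
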